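/- **Strings.** For a string $T$ let $\mathrm{Substr}(T)$ be the set of its substrings. A substring $x$ of $T$ is *left-maximal* in $T$ if $ax,bx\in\mathrm{Substr}(T)$ for two distinct characters $a,b$ or $x$ is a prefix of $T$; it is *right-maximal* in $T$ if $xa,xb\in\mathrm{Substr}(T)$ for two distinct characters $a,b$ or $x$ is a suffix of $T$. Let $\mathsf{LeftM}(T)$, $\mathsf{RightM}(T)$ be the sets of these substrings, $\mathsf M(T)=\mathsf{LeftM}(T)\cap\mathsf{RightM}(T)$ and $\mathsf{MR}(T)=\mathsf M(T)\setminus\{T\}$. Extending a substring $s$ of $T$ to the left in $T$ until it becomes left-maximal gives the shortest left-maximal substring of $T$ that has $s$ as a suffix. **CDAWG.** The compact directed acyclic word graph of $T$ has node set $\mathsf M(T)$. There is an edge with label $\beta\neq\varepsilon$ from $x\in\mathsf M(T)$ whenever $x\beta$ is right-maximal in $T$ and $x\gamma$ is not right-maximal for every non-empty proper prefix $\gamma$ of $\beta$; it leads to the node obtained by extending $x\beta$ to the left in $T$ until it becomes left-maximal. Let $\mathsf e(T)$ be the number of edges and $\mathsf d_T(x)$ the out-degree of the node $x$. **Edit.**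 Let $T'$ be obtained from $T$ by one edit operation at position $i$: the insertion of a character that becomes $T'[i]$, the substitution of another character for $T[i]$, or the deletion of $T[i]$. Assume that $T$ and $T'$ both end with the same character $\$$, which occurs only once in each of them. An occurrence $T'[j..k]$ of a non-empty string $x$ is *crossing* if, for an insertion or substitution, $k=i-1$ or $j\le i\le k$ or $j=i+1$, and, for a deletion, $k=i-1$ or $j\le i-1<i\le k$ or $j=i$. For a crossing occurrence $T'[j..k]$ of $x$ let its $S$-string be $T'[i..k]$ (which is $\varepsilon$ if $k=i-1$). Let $S_{x_L}$ and $S_{x_R}$ be the $S$-strings of the leftmost and of the rightmost crossing occurrence of $x$. **Classes of new maximal repeats.** Let $\mathsf N=(\mathsf M(T')\setminus\mathsf M(T))\setminus\{T'\}$, $\mathsf N_1=\mathsf N\cap\mathsf{RightM}(T)$, $\mathsf N_2=\mathsf N\cap\mathsf{LeftM}(T)$ and $\mathsf N_3=\mathsf N\setminus(\mathsf N_1\cup\mathsf N_2)$. Let $\mathsf N_{\mathrm{add}}$ be the set of $x\in\mathsf N_3$ such that (1) if all occurrences of $x$ in $T'$ are crossing, then $x\in\mathsf{MR}(T')$, and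 (2) for every character $a$ with $xa\in\mathrm{Substr}(T')$, some crossing occurrence of $x$ in $T'$ is followed by $a$. Let $\mathsf N_{\mathrm{base}}=\mathsf N_3\setminus\mathsf N_{\mathrm{add}}$. Associate $x\in\mathsf N_1\cup\mathsf N_{\mathrm{base}}$ with $S_{x_L}$ if there is no $y\in\mathsf N_1\cup\mathsf N_{\mathrm{base}}$ with $|y|>|x|$ and $S_{x_L}\in\{S_{y_L},S_{y_R}\}$, and with $S_{x_R}$ otherwise. Let $U(x)$ be the string obtained by extending the string associated with $x$ to the left in $T$ until it becomes left-maximal in $T$. Let $$\mathsf N_{\mathrm{mid}}=\{x\in\mathsf N_1\cup\mathsf N_{\mathrm{base}}\mid \mathsf d_{T'}(x)=\mathsf d_T(U(x))+1\},\qquad \mathsf N_{\mathrm{less}}=\{x\in\mathsf N_1\cup\mathsf N_{\mathrm{base}}\mid \mathsf d_{T'}(x)\le\mathsf d_T(U(x))\};$$ here a string $x$ for which $U(x)$ does not exist (because the associated string does not occur in $T$) belongs to neither set, and $\mathsf d_T(u)=0$ if $u$ is not a node. **Theorem.** For every such edit operation, $$\mathsf e(T')\;\le\;2\,\mathsf e(T)+5\,|\mathsf{MR}(T)|-|\mathsf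 N_{\mathrm{mid}}|-2\,|\mathsf N_{\mathrm{less}}|+|\mathsf N_2|+3 .$$ -/

import Mathlib

namespace CDAWG

variable {α : Type*}

/-! ### Maximal substrings

Strings are lists; `x <:+: T`, `x <+: T`, `x <:+ T` say that `x` is a substring, prefix, suffix
of `T`. -/

/-- The left-maximal substrings of `T`. -/
def LeftM (T : List α) : Set (List α) :=
  {x | x <:+: T ∧ ((∃ a b : α, a ≠ b ∧ (a :: x) <:+: T ∧ (b :: x) <:+: T) ∨ x <+: T)}

/-- The right-maximal substrings of `T`. -/
def RightM (T : List α) : Set (List α) :=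
  {x | x <:+: T ∧ ((∃ a b : α, a ≠ b ∧ (x ++ [a]) <:+: T ∧ (x ++ [b]) <:+: T) ∨ x <:+ T)}

/-- The maximal substrings of `T`, which are the nodes of the CDAWG of `T`. -/
def MaxSub (T : List α) : Set (List α) := LeftM T ∩ RightM T

/-- The maximal repeats of `T`. -/
def MR (T : List α) : Set (List α) := MaxSub T \ {T}

/-- `u` is obtained by extending `s` to the left in `T` until it becomes left-maximal in `T`:
it is the shortest left-maximal substring of `T` with suffix `s`. (There is none if `s` does not
occur in `T`, and exactly one otherwise.) -/
def IsLeftRep (T s u : List α) : Prop :=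
  u ∈ LeftM T ∧ s <:+ u ∧ ∀ v ∈ LeftM T, s <:+ v → u.length ≤ v.length

/-! ### The CDAWG -/

/-- The edges `(x, β, y)` of the CDAWG of `T`, from the node `x` to the node `y` with the non-empty
label `β`: the string `xβ` is the first right-maximal substring reached from `x` along `β` (so that
`β` labels an edge of the suffix tree leaving `x`), and `y` is the node in which `xβ` is merged. -/
def edges (T : List α) : Set (List α × List α × List α) :=
  {p | p.1 ∈ MaxSub T ∧ p.2.2 ∈ MaxSub T ∧ p.2.1 ≠ [] ∧
    p.1 ++ p.2.1 ∈ RightM T ∧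
    (∀ γ : List α, γ ≠ [] → γ <+: p.2.1 → γ ≠ p.2.1 → p.1 ++ γ ∉ RightM T) ∧
    IsLeftRep T (p.1 ++ p.2.1) p.2.2}

/-- The size of the CDAWG of `T`: its number of edges. -/
noncomputable def size (T : List α) : ℕ := (edges T).ncard

/-- The out-degree of the node `x` in the CDAWG of `T` (it is `0` if `x` is not a node). -/
noncomputable def outDeg (T x : List α) : ℕ := {p ∈ edges T | p.1 = x}.ncard

/-! ### Edit operations and crossing occurrences

Positions are counted from `0`; the occurrence of `x` that begins at `b` occupies the positions
`b, …, b + |x| - 1`. -/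

/-- The three kinds of single-character edit operations. -/
inductive EditKind
  | insertion
  | substitution
  | deletion

/-- `T'` is obtained from `T` by the edit operation of the given kind at position `i`: a new
character is inserted so that it becomes `T'[i]`, or `T[i]` is replaced by another character,
or `T[i]` is deleted. -/
def IsEdit : EditKind → ℕ → List α → List α → Prop
  | .insertion, i, T, T' =>
      ∃ (p s : List α) (c : α), p.length = i ∧ T = p ++ s ∧ T' = p ++ c :: s
  | .substitution, i, T, T' =>
      ∃ (p s : List α) (c d : α), c ≠ d ∧ p.length = i ∧ T = p ++ d :: s ∧ T' = p ++ c :: s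
  | .deletion, i, T, T' =>
      ∃ (p s : List α) (d : α), p.length = i ∧ T = p ++ d :: s ∧ T' = p ++ s

/-- `T` ends with the end-marker `d`, which occurs nowhere else in `T`. -/
def EndsWithMarker (d : α) (T : List α) : Prop := ∃ w : List α, d ∉ w ∧ T = w ++ [d]

/-- `x` occurs in `T` beginning at position `b`. -/
def OccursAt (T x : List α) (b : ℕ) : Prop := ∃ u v : List α, u.length = b ∧ T = u ++ x ++ v

/-- The positions `b, …, e - 1` touch the edited position `i` from the left, contain it, or touch
it from the right. (After a deletion, `i` stands for the gap between `i - 1` and `i`.) -/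
def Crosses : EditKind → ℕ → ℕ → ℕ → Prop
  | .deletion, i, b, e => e = i ∨ (b < i ∧ i < e) ∨ b = i
  | _, i, b, e => e = i ∨ (b ≤ i ∧ i < e) ∨ b = i + 1

/-- The beginning positions of the crossing occurrences of the non-empty string `x` in `T'`. -/
def crossPos (κ : EditKind) (i : ℕ) (T' x : List α) : Set ℕ :=
  {b | x ≠ [] ∧ OccursAt T' x b ∧ Crosses κ i b (b + x.length)}

/-- The substring of `T'` from the edited position `i` to the end of the occurrence of `x` that
begins at `b`; it is empty if this occurrence touches `i` from the left. -/
def sPart (i : ℕ) (T' x : List α) (b : ℕ) : List α := (T'.take (b + x.length)).drop i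

/-- The string `S` of the leftmost crossing occurrence of `x`. -/
noncomputable def sLeft (κ : EditKind) (i : ℕ) (T' x : List α) : List α :=
  sPart i T' x (sInf (crossPos κ i T' x))

/-- The string `S` of the rightmost crossing occurrence of `x`. -/
noncomputable def sRight (κ : EditKind) (i : ℕ) (T' x : List α) : List α :=
  sPart i T' x (sSup (crossPos κ i T' x))

/-! ### The classes of new maximal repeats -/

/-- The new maximal repeats. -/
def N (T T' : List α) : Set (List α) := (MaxSub T' \ MaxSub T) \ {T'}

def N₁ (T T' : List α) : Set (List α) := N T T' ∩ RightM T

def N₂ (T T' : List α) : Set (List α) := N T T' ∩ LeftM T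

def N₃ (T T' : List α) : Set (List α) := N T T' \ (N₁ T T' ∪ N₂ T T')

/-- The strings `x` of `N₃` such that `x` is a maximal repeat of `T'` if all its occurrences in
`T'` are crossing, and every right-extension of `x` in `T'` is one of a crossing occurrence. -/
def Nadd (κ : EditKind) (i : ℕ) (T T' : List α) : Set (List α) :=
  {x ∈ N₃ T T' |
    ((∀ b, OccursAt T' x b → b ∈ crossPos κ i T' x) → x ∈ MR T') ∧
    ∀ a : α, (x ++ [a]) <:+: T' → ∃ b ∈ crossPos κ i T' x, OccursAt T' (x ++ [a]) b}

def Nbase (κ : EditKind) (i : ℕ) (T T' : List α) : Set (List α) := N₃ T T' \ Nadd κ i T T'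

open Classical in
/-- The string `S` with which `x ∈ N₁ ∪ Nbase` is associated: that of the leftmost crossing
occurrence, unless it is also the string of the leftmost or rightmost crossing occurrence of a
longer member of `N₁ ∪ Nbase`, and that of the rightmost crossing occurrence in this case. -/
noncomputable def assocS (κ : EditKind) (i : ℕ) (T T' x : List α) : List α :=
  if ∃ y ∈ N₁ T T' ∪ Nbase κ i T T', x.length < y.length ∧
      (sLeft κ i T' x = sLeft κ i T' y ∨ sLeft κ i T' x = sRight κ i T' y)
  then sRight κ i T' x
  else sLeft κ i T' x

/-- `u` is the string `U(x)`. -/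
def IsU (κ : EditKind) (i : ℕ) (T T' x u : List α) : Prop := IsLeftRep T (assocS κ i T T' x) u

def Nmid (κ : EditKind) (i : ℕ) (T T' : List α) : Set (List α) :=
  {x ∈ N₁ T T' ∪ Nbase κ i T T' | ∃ u, IsU κ i T T' x u ∧ outDeg T' x = outDeg T u + 1}

def Nless (κ : EditKind) (i : ℕ) (T T' : List α) : Set (List α) :=
  {x ∈ N₁ T T' ∪ Nbase κ i T T' | ∃ u, IsU κ i T T' x u ∧ outDeg T' x ≤ outDeg T u}

end CDAWG

/-!
The out-degree of a node `x` is the number of characters that can follow `x`, so `size T'` is the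
sum of these numbers over the maximal substrings of `T'`. Crossing occurrences of the same string
overlap or touch, so by the periodicity lemma of Fine and Wilf, those between the first and the last
one are followed by the same character as the first and preceded by the same character as the last.
The edit therefore gives a string at most two new right-extensions. Let `B = N₁ ∪ Nbase`.

* A new right-extension of an old node or of a member of `N₂` is charged to the left-maximal
  substring of `T` with which it begins, up to the edit. This bounds the sum of their out-degrees by
  `size T + |N₂| + |MR T| + 1 - |Q|`, where `Q` consists of the `x ∈ Nadd` for which the argument
  yields a charge, too.
* A member of `B` has at most two more right-extensions in `T'` than its associated string has in
  `T`, with one exception, and distinct members have distinct associated strings. Together with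
  `|Nmid| + 2 |Nless|`, their out-degrees add up to at most `size T + 2 |B| + 2`.
* A member of `Nadd` has at most two right-extensions. Charging the parts of crossing occurrences
  after the edit gives `|B| + |Q| ≤ |MR T|`, and charging the parts before it, extended to the left
  in `T` where they would not be left-maximal, gives `|Nadd \ Q| ≤ |MR T|`.
-/

namespace CDAWG

variable {α : Type*}

/-! ### Occurrences -/

section Occurrences

variable {T T' x y : List α} {a : α} {b b' e e' k : ℕ}

/-- The substring of `T` on the positions `b, …, e - 1`. The strings `sPart` are windows, too. -/
def window (T : List α) (b e : ℕ) : List α := (T.take e).drop b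

theorem length_window (he : e ≤ T.length) : (window T b e).length = e - b := by
  simp [window, Nat.min_eq_left he]

theorem getElem?_window (hk : b + k < e) : (window T b e)[k]? = T[b + k]? := by
  simp [window, hk]

theorem window_prefix_window (h : e ≤ e') : window T b e <+: window T b e' :=
  (List.take_prefix_take_left h).drop b

theorem window_suffix_window (h : b ≤ b') : window T b' e <:+ window T b e := by
  rw [window, window, show b' = b + (b' - b) by omega, ← List.drop_drop]
  exact List.drop_suffix _ _

theorem occursAt_iff_prefix_drop : OccursAt T x b ↔ b ≤ T.length ∧ x <+: T.drop b := by
  constructor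
  · rintro ⟨u, v, rfl, rfl⟩
    simp
  · rintro ⟨hb, v, hv⟩
    exact ⟨T.take b, v, by simpa using hb, by rw [List.append_assoc, hv, List.take_append_drop]⟩

theorem occursAt_iff :
    OccursAt T x b ↔ b + x.length ≤ T.length ∧ ∀ k < x.length, T[b + k]? = x[k]? := by
  simp only [occursAt_iff_prefix_drop, List.prefix_iff_getElem?, List.getElem?_drop]
  constructor
  · rintro ⟨hb, h⟩
    refine ⟨?_, fun k hk => by rw [h k hk, List.getElem?_eq_getElem hk]⟩
    rcases hx : x.length with _ | n
    · omega
    · have := (List.getElem?_eq_some_iff.1 (h n (by omega))).1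
      omega
  · rintro ⟨hb, h⟩
    exact ⟨by omega, fun k hk => by rw [h k hk, List.getElem?_eq_getElem hk]⟩

theorem isInfix_iff_exists_occursAt : x <:+: T ↔ ∃ b, OccursAt T x b :=
  ⟨fun ⟨u, v, h⟩ => ⟨u.length, u, v, rfl, h.symm⟩, fun ⟨_, u, v, _, h⟩ => ⟨u, v, h.symm⟩⟩

theorem OccursAt.isInfix (h : OccursAt T x b) : x <:+: T :=
  isInfix_iff_exists_occursAt.2 ⟨b, h⟩

theorem OccursAt.add_length_le (h : OccursAt T x b) : b + x.length ≤ T.length :=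
  (occursAt_iff.1 h).1

theorem OccursAt.getElem? (h : OccursAt T x b) (hk : k < x.length) : T[b + k]? = x[k]? :=
  (occursAt_iff.1 h).2 k hk

theorem OccursAt.eq_window (h : OccursAt T x b) : x = window T b (b + x.length) := by
  obtain ⟨u, v, rfl, rfl⟩ := h
  simp [window, List.take_append]

theorem occursAt_window (hb : b ≤ e) (he : e ≤ T.length) : OccursAt T (window T b e) b := by
  rw [occursAt_iff, length_window he]
  exact ⟨by omega, fun k hk => (getElem?_window (by omega)).symm⟩

theorem OccursAt.eq_of_length_eq (hx : OccursAt T x b) (hy : OccursAt T y b)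
    (h : x.length = y.length) : x = y := by
  rw [hx.eq_window, hy.eq_window, h]

theorem occursAt_append_singleton :
    OccursAt T (x ++ [a]) b ↔ OccursAt T x b ∧ T[b + x.length]? = some a := by
  constructor
  · rintro ⟨u, v, rfl, rfl⟩
    exact ⟨⟨u, a :: v, rfl, by simp⟩, by simp⟩
  · rintro ⟨⟨u, v, rfl, rfl⟩, h⟩
    obtain ⟨v, rfl⟩ : ∃ w, v = a :: w := by
      cases v <;> simp_all
    exact ⟨u, v, rfl, by simp⟩

theorem occursAt_cons : OccursAt T (a :: x) b ↔ OccursAt T x (b + 1) ∧ T[b]? = some a := by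
  constructor
  · rintro ⟨u, v, rfl, rfl⟩
    exact ⟨⟨u ++ [a], v, by simp, by simp⟩, by simp⟩
  · rintro ⟨⟨u, v, hu, rfl⟩, h⟩
    obtain ⟨u, c, rfl⟩ := (List.eq_nil_or_concat' u).resolve_left (by rintro rfl; simp at hu)
    obtain rfl : u.length = b := by simpa using hu
    obtain rfl : c = a := by simpa using h
    exact ⟨u, v, rfl, by simp⟩

theorem OccursAt.of_prefix (h : OccursAt T y b) (hxy : x <+: y) : OccursAt T x b := by
  obtain ⟨u, v, hu, rfl⟩ := h
  obtain ⟨z, rfl⟩ := hxy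
  exact ⟨u, z ++ v, hu, by simp⟩

theorem OccursAt.of_suffix (h : OccursAt T y b) (hxy : x <:+ y) :
    OccursAt T x (b + (y.length - x.length)) := by
  obtain ⟨u, v, hu, rfl⟩ := h
  obtain ⟨z, rfl⟩ := hxy
  exact ⟨u ++ z, v, by simp [hu], by simp⟩

theorem isPrefix_iff_occursAt_zero : x <+: T ↔ OccursAt T x 0 := by
  simp [occursAt_iff_prefix_drop]

theorem isSuffix_iff_exists_occursAt :
    x <:+ T ↔ ∃ b, OccursAt T x b ∧ T[b + x.length]? = none := by
  constructor
  · rintro ⟨u, rfl⟩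
    exact ⟨u.length, ⟨u, [], rfl, by simp⟩, by simp⟩
  · rintro ⟨b, ⟨u, v, rfl, rfl⟩, hn⟩
    obtain rfl : v = [] := by simpa using hn
    exact ⟨u, by simp⟩

/-- The character to the left of position `b`. It is `none` for `b = 0`, where `b - 1` would
truncate. -/
def leftChar (T : List α) (b : ℕ) : Option α := if b = 0 then none else T[b - 1]?

theorem leftChar_zero : leftChar T 0 = none := if_pos rfl

theorem leftChar_succ : leftChar T (b + 1) = T[b]? := by simp [leftChar]

theorem leftChar_of_pos (h : 0 < b) : leftChar T b = T[b - 1]? := if_neg h.ne'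

theorem cons_isInfix_iff : (a :: x) <:+: T ↔ ∃ b, OccursAt T x b ∧ leftChar T b = some a := by
  simp only [isInfix_iff_exists_occursAt, occursAt_cons]
  constructor
  · rintro ⟨b, hx, ha⟩
    exact ⟨b + 1, hx, leftChar_succ.trans ha⟩
  · rintro ⟨_ | b, hx, ha⟩
    · simp [leftChar_zero] at ha
    · exact ⟨b, hx, leftChar_succ.symm.trans ha⟩

theorem append_singleton_isInfix_iff :
    (x ++ [a]) <:+: T ↔ ∃ b, OccursAt T x b ∧ T[b + x.length]? = some a := by
  simp only [isInfix_iff_exists_occursAt, occursAt_append_singleton]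

theorem OccursAt.exists_leftChar (h : OccursAt T x b) (hb : b ≠ 0) :
    ∃ a, leftChar T b = some a := by
  have := h.add_length_le
  exact ⟨T[b - 1]'(by omega), by rw [leftChar_of_pos (by omega)]; simp⟩

end Occurrences

/-! ### One-sided maximality -/

section Maximality

variable {T x y : List α} {b b' : ℕ} {c : α}

/-- All occurrences of `x` in `T` are preceded by `c`. For a substring `x` of `T`, this holds for
some `c` if and only if `x` is not left-maximal. -/
def PrecededOnlyBy (T x : List α) (c : α) : Prop := ∀ b, OccursAt T x b → leftChar T b = some c

/-- All occurrences of `x` in `T` are followed by `c`. For a substring `x` of `T`, this holds for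
some `c` if and only if `x` is not right-maximal. -/
def FollowedOnlyBy (T x : List α) (c : α) : Prop :=
  ∀ b, OccursAt T x b → T[b + x.length]? = some c

theorem mem_leftM_of_occursAt_zero (h : OccursAt T x 0) : x ∈ LeftM T :=
  ⟨h.isInfix, Or.inr (isPrefix_iff_occursAt_zero.2 h)⟩

theorem mem_leftM_of_leftChar_ne (h : OccursAt T x b) (h' : OccursAt T x b')
    (hne : leftChar T b ≠ leftChar T b') : x ∈ LeftM T := by
  rcases eq_or_ne b 0 with rfl | hb
  · exact mem_leftM_of_occursAt_zero h
  rcases eq_or_ne b' 0 with rfl | hb'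
  · exact mem_leftM_of_occursAt_zero h'
  obtain ⟨a, ha⟩ := h.exists_leftChar hb
  obtain ⟨a', ha'⟩ := h'.exists_leftChar hb'
  exact ⟨h.isInfix, Or.inl ⟨a, a', by rintro rfl; exact hne (ha.trans ha'.symm),
    cons_isInfix_iff.2 ⟨b, h, ha⟩, cons_isInfix_iff.2 ⟨b', h', ha'⟩⟩⟩

theorem mem_rightM_of_rightChar_ne (h : OccursAt T x b) (h' : OccursAt T x b')
    (hne : T[b + x.length]? ≠ T[b' + x.length]?) : x ∈ RightM T := by
  refine ⟨h.isInfix, ?_⟩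
  cases hb : T[b + x.length]? with
  | none => exact Or.inr (isSuffix_iff_exists_occursAt.2 ⟨b, h, hb⟩)
  | some a =>
    cases hb' : T[b' + x.length]? with
    | none => exact Or.inr (isSuffix_iff_exists_occursAt.2 ⟨b', h', hb'⟩)
    | some a' =>
      exact Or.inl ⟨a, a', by rintro rfl; exact hne (hb.trans hb'.symm),
        append_singleton_isInfix_iff.2 ⟨b, h, hb⟩, append_singleton_isInfix_iff.2 ⟨b', h', hb'⟩⟩

theorem exists_precededOnlyBy (h : x <:+: T) (hx : x ∉ LeftM T) : ∃ c, PrecededOnlyBy T x c := by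
  obtain ⟨b, hb⟩ := isInfix_iff_exists_occursAt.1 h
  obtain ⟨c, hc⟩ := hb.exists_leftChar (by rintro rfl; exact hx (mem_leftM_of_occursAt_zero hb))
  refine ⟨c, fun b' hb' => ?_⟩
  by_contra hne
  exact hx (mem_leftM_of_leftChar_ne hb' hb (by rwa [hc]))

theorem exists_followedOnlyBy (h : x <:+: T) (hx : x ∉ RightM T) : ∃ c, FollowedOnlyBy T x c := by
  obtain ⟨b, hb⟩ := isInfix_iff_exists_occursAt.1 h
  cases hc : T[b + x.length]? with
  | none => exact absurd ⟨h, Or.inr (isSuffix_iff_exists_occursAt.2 ⟨b, hb, hc⟩)⟩ hx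
  | some c =>
    refine ⟨c, fun b' hb' => ?_⟩
    by_contra hne
    exact hx (mem_rightM_of_rightChar_ne hb' hb (by rwa [hc]))

theorem exists_leftChar_ne (hx : x ∈ LeftM T) (c : α) :
    ∃ b, OccursAt T x b ∧ leftChar T b ≠ some c := by
  rcases hx.2 with ⟨a, a', hne, h, h'⟩ | h
  · obtain ⟨b, hb, e⟩ := cons_isInfix_iff.1 h
    obtain ⟨b', hb', e'⟩ := cons_isInfix_iff.1 h'
    rcases eq_or_ne a c with rfl | hac
    · exact ⟨b', hb', by simpa [e'] using hne.symm⟩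
    · exact ⟨b, hb, by simpa [e] using hac⟩
  · exact ⟨0, isPrefix_iff_occursAt_zero.1 h, by simp [leftChar_zero]⟩

theorem exists_rightChar_ne (hx : x ∈ RightM T) (c : α) :
    ∃ b, OccursAt T x b ∧ T[b + x.length]? ≠ some c := by
  rcases hx.2 with ⟨a, a', hne, h, h'⟩ | h
  · obtain ⟨b, hb, e⟩ := append_singleton_isInfix_iff.1 h
    obtain ⟨b', hb', e'⟩ := append_singleton_isInfix_iff.1 h'
    rcases eq_or_ne a c with rfl | hac
    · exact ⟨b', hb', by simpa [e'] using hne.symm⟩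
    · exact ⟨b, hb, by simpa [e] using hac⟩
  · obtain ⟨b, hb, e⟩ := isSuffix_iff_exists_occursAt.1 h
    exact ⟨b, hb, by simp [e]⟩

theorem mem_leftM_of_prefix (hy : y ∈ LeftM T) (h : x <+: y) : x ∈ LeftM T := by
  by_contra hx
  obtain ⟨c, hc⟩ := exists_precededOnlyBy (h.isInfix.trans hy.1) hx
  obtain ⟨b, hb, hne⟩ := exists_leftChar_ne hy c
  exact hne (hc b (hb.of_prefix h))

theorem mem_rightM_of_suffix (hy : y ∈ RightM T) (h : x <:+ y) : x ∈ RightM T := by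
  by_contra hx
  obtain ⟨c, hc⟩ := exists_followedOnlyBy (h.isInfix.trans hy.1) hx
  obtain ⟨b, hb, hne⟩ := exists_rightChar_ne hy c
  have := hc _ (hb.of_suffix h)
  have hl := h.length_le
  rw [show b + (y.length - x.length) + x.length = b + y.length by omega] at this
  exact hne this

theorem nil_mem_maxSub (T : List α) : [] ∈ MaxSub T :=
  ⟨⟨List.nil_infix, Or.inr List.nil_prefix⟩, List.nil_infix, Or.inr List.nil_suffix⟩

theorem self_mem_maxSub (T : List α) : T ∈ MaxSub T :=
  ⟨⟨List.infix_rfl, Or.inr List.prefix_rfl⟩, List.infix_rfl, Or.inr List.suffix_rfl⟩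

end Maximality

/-! ### Three overlapping occurrences -/

-- Euclid's algorithm on the periods `q` and `r`, as in the theorem of Fine and Wilf.
theorem apply_pred_eq_of_two_periods {β : Type*} {f : ℕ → β} {n q r : ℕ} (hq : 0 < q) (hr : 0 < r)
    (hn : q + r ≤ n + 1) (pq : ∀ k, k + q < n → f k = f (k + q))
    (pr : ∀ k, k + r < n → f k = f (k + r)) : f (q - 1) = f (r - 1) := by
  induction hs : q + r using Nat.strong_induction_on generalizing n q r with
  | _ s ih =>
    rcases lt_trichotomy q r with h | rfl | h
    · have ih' : f (q - 1) = f (r - q - 1) :=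
        ih (q + (r - q)) (by omega) (n := n - q) hq (by omega) (by omega)
          (fun k hk => pq k (by omega))
          (fun k hk => by
            rw [pr k (by omega), pq (k + (r - q)) (by omega)]; congr 1; omega) rfl
      rw [ih', pq (r - q - 1) (by omega)]
      congr 1; omega
    · rfl
    · have ih' : f (q - r - 1) = f (r - 1) :=
        ih (q - r + r) (by omega) (n := n - r) (by omega) hr (by omega)
          (fun k hk => by
            rw [pq k (by omega), pr (k + (q - r)) (by omega)]; congr 1; omega)
          (fun k hk => pr k (by omega)) rfl
      rw [← ih', pr (q - r - 1) (by omega)]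
      congr 1; omega

section Triple

variable {T x : List α} {b b' b₁ b₂ b₃ k : ℕ}

theorem getElem?_add_sub_of_occursAt (h : OccursAt T x b) (h' : OccursAt T x b') (hb : b ≤ b')
    (hk : k + (b' - b) < x.length) : x[k]? = x[k + (b' - b)]? := by
  rw [← h'.getElem? (by omega), ← h.getElem? hk]
  congr 1; omega

theorem getElem?_gap_eq_of_three (h₁ : OccursAt T x b₁) (h₂ : OccursAt T x b₂)
    (h₃ : OccursAt T x b₃) (h₁₂ : b₁ < b₂) (h₂₃ : b₂ < b₃) (hn : b₃ ≤ b₁ + x.length + 1) :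
    x[b₂ - b₁ - 1]? = x[b₃ - b₂ - 1]? :=
  apply_pred_eq_of_two_periods (f := fun k => x[k]?) (n := x.length) (by omega) (by omega)
    (by omega) (fun _ => getElem?_add_sub_of_occursAt h₁ h₂ h₁₂.le)
    (fun _ => getElem?_add_sub_of_occursAt h₂ h₃ h₂₃.le)

theorem leftChar_eq_of_three (h₁ : OccursAt T x b₁) (h₂ : OccursAt T x b₂) (h₃ : OccursAt T x b₃)
    (h₁₂ : b₁ < b₂) (h₂₃ : b₂ < b₃) (hn : b₃ ≤ b₁ + x.length + 1) :
    leftChar T b₂ = leftChar T b₃ := by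
  rw [leftChar_of_pos (by omega), leftChar_of_pos (by omega),
    show b₂ - 1 = b₁ + (b₂ - b₁ - 1) by omega, show b₃ - 1 = b₂ + (b₃ - b₂ - 1) by omega,
    h₁.getElem? (by omega), h₂.getElem? (by omega)]
  exact getElem?_gap_eq_of_three h₁ h₂ h₃ h₁₂ h₂₃ hn

theorem rightChar_eq_of_three (h₁ : OccursAt T x b₁) (h₂ : OccursAt T x b₂) (h₃ : OccursAt T x b₃)
    (h₁₂ : b₁ < b₂) (h₂₃ : b₂ < b₃) (hn : b₃ ≤ b₁ + x.length + 1) :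
    T[b₁ + x.length]? = T[b₂ + x.length]? := by
  rw [show b₁ + x.length = b₂ + (x.length - (b₂ - b₁)) by omega,
    show b₂ + x.length = b₃ + (x.length - (b₃ - b₂)) by omega,
    h₂.getElem? (by omega), h₃.getElem? (by omega)]
  rcases hn.lt_or_eq with hlt | heq
  · have p₁ := getElem?_add_sub_of_occursAt (k := x.length - (b₃ - b₁)) h₁ h₂ h₁₂.le (by omega)
    have p₂ := getElem?_add_sub_of_occursAt (k := x.length - (b₃ - b₁)) h₂ h₃ h₂₃.le (by omega)
    rw [show x.length - (b₂ - b₁) = x.length - (b₃ - b₁) + (b₃ - b₂) by omega, ← p₂, p₁]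
    congr 1; omega
  · rw [show x.length - (b₂ - b₁) = b₃ - b₂ - 1 by omega,
      show x.length - (b₃ - b₂) = b₂ - b₁ - 1 by omega]
    exact (getElem?_gap_eq_of_three h₁ h₂ h₃ h₁₂ h₂₃ hn).symm

end Triple

/-! ### Extension to one-sided maximal substrings -/

section Extension

variable {T s s₁ s₂ u v : List α}

/-- `s` is a suffix of `u`, and each occurrence of `s` in `T` is the end of one of `u`. -/
def LeftExt (T s u : List α) : Prop :=
  s <:+ u ∧ ∀ b, OccursAt T s b → ∃ k, k + u.length = b + s.length ∧ OccursAt T u k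

/-- `s` is a prefix of `u`, and each occurrence of `s` in `T` is the beginning of one of `u`. -/
def RightExt (T s u : List α) : Prop := s <+: u ∧ ∀ b, OccursAt T s b → OccursAt T u b

theorem exists_leftExt (h : s <:+: T) : ∃ u ∈ LeftM T, LeftExt T s u := by
  obtain ⟨b, hb⟩ := isInfix_iff_exists_occursAt.1 h
  clear h
  induction b generalizing s with
  | zero => exact ⟨s, mem_leftM_of_occursAt_zero hb, List.suffix_rfl, fun b hb => ⟨b, rfl, hb⟩⟩
  | succ b ih =>
    by_cases hs : s ∈ LeftM T
    · exact ⟨s, hs, List.suffix_rfl, fun b hb => ⟨b, rfl, hb⟩⟩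
    · obtain ⟨c, hc⟩ := exists_precededOnlyBy hb.isInfix hs
      obtain ⟨u, hu, hsu, hext⟩ :=
        ih (s := c :: s) (occursAt_cons.2 ⟨hb, by rw [← leftChar_succ, hc _ hb]⟩)
      refine ⟨u, hu, (List.suffix_cons c s).trans hsu, fun b' hb' => ?_⟩
      have h' := hc b' hb'
      rcases b' with _ | b'
      · simp [leftChar_zero] at h'
      · obtain ⟨b'', e, ho⟩ := hext b' (occursAt_cons.2 ⟨hb', by rwa [leftChar_succ] at h'⟩)
        exact ⟨b'', by rw [e, List.length_cons]; omega, ho⟩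

theorem exists_rightExt (h : s <:+: T) : ∃ u ∈ RightM T, RightExt T s u := by
  obtain ⟨b, hb⟩ := isInfix_iff_exists_occursAt.1 h
  clear h
  induction hk : T.length - (b + s.length) using Nat.strong_induction_on generalizing s with
  | _ k ih =>
    by_cases hs : s ∈ RightM T
    · exact ⟨s, hs, List.prefix_rfl, fun _ => id⟩
    · obtain ⟨c, hc⟩ := exists_followedOnlyBy hb.isInfix hs
      have hsc : ∀ b, OccursAt T s b → OccursAt T (s ++ [c]) b := fun b hb =>
        occursAt_append_singleton.2 ⟨hb, hc b hb⟩
      have hlt : T.length - (b + (s ++ [c]).length) < k := by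
        have := (hsc b hb).add_length_le
        simp only [List.length_append, List.length_singleton] at this ⊢
        omega
      obtain ⟨u, hu, hsu, hext⟩ := ih _ hlt (hsc b hb) rfl
      exact ⟨u, hu, (List.prefix_append s [c]).trans hsu, fun b' hb' => hext b' (hsc b' hb')⟩

theorem LeftExt.isInfix (h : LeftExt T s u) (hs : s <:+: T) : u <:+: T := by
  obtain ⟨b, hb⟩ := isInfix_iff_exists_occursAt.1 hs
  obtain ⟨_, _, hu⟩ := h.2 b hb
  exact hu.isInfix

theorem RightExt.isInfix (h : RightExt T s u) (hs : s <:+: T) : u <:+: T := by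
  obtain ⟨b, hb⟩ := isInfix_iff_exists_occursAt.1 hs
  exact (h.2 b hb).isInfix

theorem LeftExt.mem_rightM (h : LeftExt T s u) (hs : s ∈ RightM T) : u ∈ RightM T := by
  by_contra hn
  obtain ⟨c, hc⟩ := exists_followedOnlyBy (h.isInfix hs.1) hn
  obtain ⟨b, hb, hne⟩ := exists_rightChar_ne hs c
  obtain ⟨b', e, h'⟩ := h.2 b hb
  exact hne (by rw [← e, hc b' h'])

theorem RightExt.mem_leftM (h : RightExt T s u) (hs : s ∈ LeftM T) : u ∈ LeftM T := by
  by_contra hn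
  obtain ⟨c, hc⟩ := exists_precededOnlyBy (h.isInfix hs.1) hn
  obtain ⟨b, hb, hne⟩ := exists_leftChar_ne hs c
  exact hne (hc b (h.2 b hb))

theorem LeftExt.isLeftRep (h : LeftExt T s u) (hu : u ∈ LeftM T) : IsLeftRep T s u := by
  refine ⟨hu, h.1, fun v hv hsv => ?_⟩
  by_contra hlt
  push Not at hlt
  have hsl := hsv.length_le
  obtain ⟨b, hb, hne⟩ := exists_leftChar_ne hv (u[u.length - v.length - 1]'(by omega))
  obtain ⟨b', e, h'⟩ := h.2 _ (hb.of_suffix hsv)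
  apply hne
  rw [leftChar_of_pos (by omega), show b - 1 = b' + (u.length - v.length - 1) by omega,
    h'.getElem? (by omega)]
  simp

theorem LeftExt.eq_of_isLeftRep (h : LeftExt T s u) (hu : u ∈ LeftM T) (hv : IsLeftRep T s v) :
    u = v := by
  have huv : u.length = v.length :=
    le_antisymm ((h.isLeftRep hu).2.2 v hv.1 hv.2.1) (hv.2.2 u hu h.1)
  obtain ⟨b, hb⟩ := isInfix_iff_exists_occursAt.1 hv.1.1
  obtain ⟨b', e, h'⟩ := h.2 _ (hb.of_suffix hv.2.1)
  have := hv.2.1.length_le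
  obtain rfl : b' = b := by omega
  exact h'.eq_of_length_eq hb huv

-- If `s₁` were shorter, the first occurrence of `u` would give rise to an earlier one.
theorem LeftExt.eq_of_prefix (h : LeftExt T s₁ u) (hu : u <:+: T) (h₂ : s₂ <:+ u)
    (h₁₂ : s₁ <+: s₂) : s₁ = s₂ := by
  by_contra hne
  have hlt : s₁.length < s₂.length :=
    h₁₂.length_le.lt_of_ne fun e => hne (h₁₂.eq_of_length e)
  have no_first : ∀ b, ¬ OccursAt T u b := fun b => by
    induction b using Nat.strong_induction_on with
    | _ b ih =>
      intro hb
      obtain ⟨b', e, h'⟩ := h.2 _ ((hb.of_suffix h₂).of_prefix h₁₂)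
      have := h₂.length_le
      exact ih b' (by omega) h'
  obtain ⟨b, hb⟩ := isInfix_iff_exists_occursAt.1 hu
  exact no_first b hb

theorem RightExt.eq_of_suffix (h : RightExt T s₁ u) (hu : u <:+: T) (h₂ : s₂ <+: u)
    (h₁₂ : s₁ <:+ s₂) : s₁ = s₂ := by
  by_contra hne
  have hlt : s₁.length < s₂.length :=
    h₁₂.length_le.lt_of_ne fun e => hne (h₁₂.eq_of_length e)
  have no_last : ∀ k b, T.length - b = k → ¬ OccursAt T u b := fun k => by
    induction k using Nat.strong_induction_on with
    | _ k ih =>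
      intro b hk hb
      have h' := h.2 _ ((hb.of_prefix h₂).of_suffix h₁₂)
      have := h'.add_length_le
      exact ih _ (by omega) _ rfl h'
  obtain ⟨b, hb⟩ := isInfix_iff_exists_occursAt.1 hu
  exact no_last _ b rfl hb

open Classical in
/-- The string obtained by extending the substring `s` of `T` to the left until it becomes
left-maximal; it is `s` itself if `s` does not occur in `T`. -/
noncomputable def leftMax (T s : List α) : List α :=
  if h : s <:+: T then (exists_leftExt h).choose else s

open Classical in
/-- The string obtained by extending the substring `s` of `T` to the right until it becomes
right-maximal; it is `s` itself if `s` does not occur in `T`. -/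
noncomputable def rightMax (T s : List α) : List α :=
  if h : s <:+: T then (exists_rightExt h).choose else s

theorem leftMax_mem_leftM (h : s <:+: T) : leftMax T s ∈ LeftM T := by
  rw [leftMax, dif_pos h]
  exact (exists_leftExt h).choose_spec.1

theorem leftExt_leftMax (h : s <:+: T) : LeftExt T s (leftMax T s) := by
  rw [leftMax, dif_pos h]
  exact (exists_leftExt h).choose_spec.2

theorem rightMax_mem_rightM (h : s <:+: T) : rightMax T s ∈ RightM T := by
  rw [rightMax, dif_pos h]
  exact (exists_rightExt h).choose_spec.1

theorem rightExt_rightMax (h : s <:+: T) : RightExt T s (rightMax T s) := by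
  rw [rightMax, dif_pos h]
  exact (exists_rightExt h).choose_spec.2

theorem leftMax_mem_maxSub (h : s ∈ RightM T) : leftMax T s ∈ MaxSub T :=
  ⟨leftMax_mem_leftM h.1, (leftExt_leftMax h.1).mem_rightM h⟩

theorem rightMax_mem_maxSub (h : s ∈ LeftM T) : rightMax T s ∈ MaxSub T :=
  ⟨(rightExt_rightMax h.1).mem_leftM h, rightMax_mem_rightM h.1⟩

theorem isLeftRep_leftMax (h : s <:+: T) : IsLeftRep T s (leftMax T s) :=
  (leftExt_leftMax h).isLeftRep (leftMax_mem_leftM h)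

theorem IsLeftRep.eq_leftMax (h : IsLeftRep T s u) : u = leftMax T s :=
  have hs : s <:+: T := h.2.1.isInfix.trans h.1.1
  ((leftExt_leftMax hs).eq_of_isLeftRep (leftMax_mem_leftM hs) h).symm

theorem injOn_leftMax_of_isChain {A : Set (List α)} (hA : IsChain (· <+: ·) A)
    (hT : ∀ s ∈ A, s <:+: T) : Set.InjOn (leftMax T) A := by
  have key : ∀ s₁ ∈ A, ∀ s₂ ∈ A, leftMax T s₁ = leftMax T s₂ → s₁ <+: s₂ → s₁ = s₂ :=
    fun s₁ h₁ s₂ h₂ e hpre => (leftExt_leftMax (hT s₁ h₁)).eq_of_prefix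
      (leftMax_mem_leftM (hT s₁ h₁)).1 (e ▸ (leftExt_leftMax (hT s₂ h₂)).1) hpre
  exact fun s₁ h₁ s₂ h₂ e => (hA.total h₁ h₂).elim (key s₁ h₁ s₂ h₂ e)
    fun hpre => (key s₂ h₂ s₁ h₁ e.symm hpre).symm

theorem injOn_rightMax_of_isChain {A : Set (List α)} (hA : IsChain (· <:+ ·) A)
    (hT : ∀ s ∈ A, s <:+: T) : Set.InjOn (rightMax T) A := by
  have key : ∀ s₁ ∈ A, ∀ s₂ ∈ A, rightMax T s₁ = rightMax T s₂ → s₁ <:+ s₂ → s₁ = s₂ :=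
    fun s₁ h₁ s₂ h₂ e hsuf => (rightExt_rightMax (hT s₁ h₁)).eq_of_suffix
      (rightMax_mem_rightM (hT s₁ h₁)).1 (e ▸ (rightExt_rightMax (hT s₂ h₂)).1) hsuf
  exact fun s₁ h₁ s₂ h₂ e => (hA.total h₁ h₂).elim (key s₁ h₁ s₂ h₂ e)
    fun hsuf => (key s₂ h₂ s₁ h₁ e.symm hsuf).symm

theorem leftMax_mem_mr (hs : s ∈ RightM T) {c : α} (hc : (s ++ [c]) <:+: T) :
    leftMax T s ∈ MR T := by
  refine ⟨leftMax_mem_maxSub hs, fun hT : leftMax T s = T => ?_⟩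
  obtain ⟨b, hb, hbc⟩ := append_singleton_isInfix_iff.1 hc
  obtain ⟨k, hk, hu⟩ := (leftExt_leftMax hs.1).2 b hb
  have := (List.getElem?_eq_some_iff.1 hbc).1
  have := hu.add_length_le
  rw [hT] at hk
  omega

theorem rightMax_mem_mr (hs : s ∈ LeftM T) {b b' : ℕ} (hne : b ≠ b') (hb : OccursAt T s b)
    (hb' : OccursAt T s b') : rightMax T s ∈ MR T := by
  refine ⟨rightMax_mem_maxSub hs, fun hT : rightMax T s = T => ?_⟩
  have h := ((rightExt_rightMax hs.1).2 b hb).add_length_le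
  have h' := ((rightExt_rightMax hs.1).2 b' hb').add_length_le
  rw [hT] at h h'
  omega

end Extension

section Extension

variable {T s u v : List α}

theorem RightExt.notMem_rightM (h : RightExt T s u) (hsv : s <+: v) (hvu : v <+: u)
    (hne : v ≠ u) : v ∉ RightM T := by
  obtain ⟨t, rfl⟩ := hvu
  rcases t with _ | ⟨c, t⟩
  · simp at hne
  intro hv
  obtain ⟨b, hb, hbc⟩ := exists_rightChar_ne hv c
  have hvc : OccursAt T (v ++ [c]) b := (h.2 b (hb.of_prefix hsv)).of_prefix ⟨t, by simp⟩
  exact hbc (occursAt_append_singleton.1 hvc).2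

theorem rightExt_of_forall_notMem_rightM (hu : u <:+: T) (hsu : s <+: u)
    (h : ∀ v, s <+: v → v <+: u → v ≠ u → v ∉ RightM T) : RightExt T s u := by
  obtain ⟨t, rfl⟩ := hsu
  induction t generalizing s with
  | nil => simp [RightExt]
  | cons a t ih =>
    have hsa : s ++ [a] <+: s ++ a :: t := ⟨t, by simp⟩
    obtain ⟨c, hc⟩ := exists_followedOnlyBy ((List.prefix_append _ _).isInfix.trans hu)
      (h s List.prefix_rfl (List.prefix_append _ _) (by simp))
    obtain ⟨b, hb⟩ := isInfix_iff_exists_occursAt.1 (hsa.isInfix.trans hu)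
    rw [occursAt_append_singleton] at hb
    obtain rfl : c = a := Option.some_injective _ ((hc b hb.1).symm.trans hb.2)
    have ih' : RightExt T (s ++ [c]) (s ++ [c] ++ t) := ih (by simpa using hu)
      fun v hv hvu hne =>
        h v ((List.prefix_append _ _).trans hv) (by simpa using hvu) (by simpa using hne)
    refine ⟨List.prefix_append _ _, fun k hk => ?_⟩
    simpa using ih'.2 k (occursAt_append_singleton.2 ⟨hk, hc k hk⟩)

theorem RightExt.eq_rightMax (h : RightExt T s u) (hu : u ∈ RightM T) : u = rightMax T s := by
  have hs : s <:+: T := h.1.isInfix.trans hu.1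
  have h' := rightExt_rightMax hs
  obtain ⟨b, hb⟩ := isInfix_iff_exists_occursAt.1 hs
  by_contra hne
  rcases List.prefix_or_prefix_of_prefix (occursAt_iff_prefix_drop.1 (h.2 b hb)).2
    (occursAt_iff_prefix_drop.1 (h'.2 b hb)).2 with hp | hp
  · exact h'.notMem_rightM h.1 hp hne hu
  · exact h.notMem_rightM h'.1 hp (Ne.symm hne) (rightMax_mem_rightM hs)

end Extension

/-! ### Degrees -/

section Degrees

variable {T s u x β y : List α} {a : α}

theorem finite_substrings (T : List α) : {x | x <:+: T}.Finite :=
  (List.finite_toSet T.sublists).subset fun _ hx => List.mem_sublists.2 hx.sublist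

theorem finite_maxSub (T : List α) : (MaxSub T).Finite :=
  (finite_substrings T).subset fun _ hx => hx.1.1

theorem finite_mr (T : List α) : (MR T).Finite := (finite_maxSub T).subset Set.sdiff_subset

theorem ncard_maxSub (T : List α) : (MaxSub T).ncard = (MR T).ncard + 1 :=
  (Set.ncard_sdiff_singleton_add_one (self_mem_maxSub T) (finite_maxSub T)).symm

theorem finite_edges (T : List α) : (edges T).Finite := by
  refine ((finite_substrings T).prod ((finite_substrings T).prod (finite_substrings T))).subset ?_
  rintro ⟨x, β, y⟩ ⟨hx, hy, _, h, _, _⟩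
  exact ⟨hx.1.1, (List.suffix_append x β).isInfix.trans h.1, hy.1.1⟩

/-- The set of the characters that follow an occurrence of `x` in `T`. -/
def rightChars (T x : List α) : Set α := {a | (x ++ [a]) <:+: T}

/-- The number of right-extensions of `x` in `T`. Unlike `outDeg`, it does not depend on `x` being a
node. -/
noncomputable def rightDeg (T x : List α) : ℕ := (rightChars T x).ncard

theorem finite_rightChars (T x : List α) : (rightChars T x).Finite :=
  (List.finite_toSet T).subset fun _ ha => ha.subset (by simp)

theorem rightChars_subset_of_suffix (h : s <:+ u) : rightChars T u ⊆ rightChars T s := by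
  intro a ha
  obtain ⟨z, rfl⟩ := h
  exact (show s ++ [a] <:+: z ++ s ++ [a] from ⟨z, [], by simp⟩).trans ha

theorem rightDeg_le_of_suffix (h : s <:+ u) : rightDeg T u ≤ rightDeg T s :=
  Set.ncard_le_ncard (rightChars_subset_of_suffix h) (finite_rightChars T s)

theorem LeftExt.rightDeg_eq (h : LeftExt T s u) : rightDeg T u = rightDeg T s := by
  refine congrArg Set.ncard ((rightChars_subset_of_suffix h.1).antisymm fun a ha => ?_)
  obtain ⟨b, hb, hc⟩ := append_singleton_isInfix_iff.1 ha
  obtain ⟨b', e, h'⟩ := h.2 b hb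
  exact append_singleton_isInfix_iff.2 ⟨b', h', by rw [e, hc]⟩

theorem rightDeg_self (T : List α) : rightDeg T T = 0 := by
  have : rightChars T T = ∅ := Set.eq_empty_of_forall_notMem fun a ha => by
    simpa using List.IsInfix.length_le ha
  rw [rightDeg, this, Set.ncard_empty]

theorem rightDeg_le_one (hx : x ∉ RightM T) : rightDeg T x ≤ 1 := by
  rw [rightDeg, Set.ncard_le_one (finite_rightChars T x)]
  intro a ha b hb
  by_contra hne
  exact hx ⟨(List.prefix_append x [a]).isInfix.trans ha, Or.inl ⟨a, b, hne, ha, hb⟩⟩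

theorem rightExt_of_mem_edges (h : (x, a :: β, y) ∈ edges T) :
    RightExt T (x ++ [a]) (x ++ a :: β) := by
  obtain ⟨-, -, -, hR, hmin, -⟩ := h
  refine rightExt_of_forall_notMem_rightM hR.1 ⟨β, by simp⟩ ?_
  rintro _ ⟨γ, rfl⟩ hv hne
  rw [List.append_assoc] at hv hne ⊢
  exact hmin _ (by simp) ((List.prefix_append_right_inj x).1 hv) (by simpa using hne)

theorem mem_edges_iff :
    (x, a :: β, y) ∈ edges T ↔ x ∈ MaxSub T ∧ a ∈ rightChars T x ∧
      x ++ a :: β = rightMax T (x ++ [a]) ∧ y = leftMax T (rightMax T (x ++ [a])) := by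
  constructor
  · intro h
    have hext := rightExt_of_mem_edges h
    obtain ⟨hx, -, -, hR, -, hrep⟩ := h
    have heq : x ++ a :: β = rightMax T (x ++ [a]) := hext.eq_rightMax hR
    exact ⟨hx, hext.1.isInfix.trans hR.1, heq, heq ▸ hrep.eq_leftMax⟩
  · rintro ⟨hx, ha, heq, rfl⟩
    have hext := rightExt_rightMax ha
    have hR := rightMax_mem_rightM ha
    rw [← heq] at hext hR ⊢
    refine ⟨hx, leftMax_mem_maxSub hR, by simp, hR, fun γ hγ hpre hne => ?_,
      isLeftRep_leftMax hR.1⟩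
    obtain ⟨c, γ, rfl⟩ := List.exists_cons_of_ne_nil hγ
    obtain ⟨rfl, -⟩ := List.cons_prefix_cons.1 hpre
    exact hext.notMem_rightM ⟨γ, by simp⟩ ((List.prefix_append_right_inj x).2 hpre)
      (by simpa using hne)

theorem outDeg_eq_rightDeg (hx : x ∈ MaxSub T) : outDeg T x = rightDeg T x := by
  refine Set.ncard_congr (fun p hp => p.2.1.head hp.1.2.2.1) ?_ ?_ ?_
  · rintro ⟨x, _ | ⟨a, β⟩, y⟩ ⟨h, rfl⟩
    · exact absurd rfl h.2.2.1
    · exact (mem_edges_iff.1 h).2.1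
  · rintro ⟨x, _ | ⟨a, β⟩, y⟩ ⟨x', _ | ⟨a', β'⟩, y'⟩ ⟨h, rfl⟩ ⟨h', rfl : x' = x⟩ e
    · exact absurd rfl h.2.2.1
    · exact absurd rfl h.2.2.1
    · exact absurd rfl h'.2.2.1
    · obtain rfl : a = a' := e
      obtain ⟨-, -, hβ, rfl⟩ := mem_edges_iff.1 h
      obtain ⟨-, -, hβ', rfl⟩ := mem_edges_iff.1 h'
      simpa using hβ.trans hβ'.symm
  · intro a ha
    obtain ⟨β, hβ⟩ := (rightExt_rightMax ha).1
    rw [List.append_assoc] at hβ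
    exact ⟨(x, a :: β, _), ⟨mem_edges_iff.2 ⟨hx, ha, hβ, rfl⟩, rfl⟩, rfl⟩

theorem outDeg_le_rightDeg (T x : List α) : outDeg T x ≤ rightDeg T x := by
  by_cases hx : x ∈ MaxSub T
  · exact (outDeg_eq_rightDeg hx).le
  · have : {p ∈ edges T | p.1 = x} = ∅ := by
      refine Set.eq_empty_of_forall_notMem ?_
      rintro p ⟨hp, rfl⟩
      exact hx hp.1
    simp [outDeg, this]

theorem size_eq_sum_rightDeg (T : List α) :
    size T = ∑ x ∈ (finite_maxSub T).toFinset, rightDeg T x := by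
  classical
  rw [size, Set.ncard_eq_toFinset_card _ (finite_edges T),
    Finset.card_eq_sum_card_fiberwise (f := Prod.fst) (t := (finite_maxSub T).toFinset)
      fun p hp => by
        simp only [Finset.mem_coe, Set.Finite.mem_toFinset] at hp ⊢
        exact hp.1]
  refine Finset.sum_congr rfl fun x hx => ?_
  rw [← outDeg_eq_rightDeg ((Set.Finite.mem_toFinset _).1 hx), outDeg, ← Set.ncard_coe_finset]
  congr 1
  ext p
  simp

theorem sum_rightDeg_le_size {ι : Type*} {A : Finset ι} {g : ι → List α} (hinj : Set.InjOn g A)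
    (hg : ∀ a ∈ A, g a ∈ MaxSub T) : ∑ a ∈ A, rightDeg T (g a) ≤ size T := by
  classical
  rw [size_eq_sum_rightDeg, ← Finset.sum_image hinj]
  refine Finset.sum_le_sum_of_subset (Finset.image_subset_iff.2 fun a ha => ?_)
  exact (Set.Finite.mem_toFinset _).2 (hg a ha)

theorem card_le_ncard_mr {ι : Type*} {A : Finset ι} {g : ι → List α} (hinj : Set.InjOn g A)
    (hg : ∀ a ∈ A, g a ∈ MR T) : A.card ≤ (MR T).ncard :=
  Set.ncard_coe_finset A ▸ Set.ncard_le_ncard_of_injOn g hg hinj (finite_mr T)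

end Degrees

/-! ### Edited texts -/

/-- The position in `T'` from which on the edit at position `i` has changed nothing. -/
def EditKind.off : EditKind → ℕ → ℕ
  | .deletion, i => i
  | _, i => i + 1

/-- The position in `T` that corresponds to the position `EditKind.off` in `T'`. -/
def EditKind.resume : EditKind → ℕ → ℕ
  | .insertion, i => i
  | _, i => i + 1

theorem crosses_iff {κ : EditKind} {i b e : ℕ} (h : b < e) :
    Crosses κ i b e ↔ i ≤ e ∧ b ≤ κ.off i := by
  cases κ <;> simp only [Crosses, EditKind.off] <;> omega

/-- `T` and `T'` agree before position `i`, and from position `j` of `T` and `off ∈ {i, i + 1}` of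
`T'` on. This is all that the counting uses of an edit operation. -/
structure Edited (T T' : List α) (i off j : ℕ) : Prop where
  le_off : i ≤ off
  off_le : off ≤ i + 1
  le_resume : i ≤ j
  off_le_length : off ≤ T'.length
  resume_le_length : j ≤ T.length
  take_eq : T.take i = T'.take i
  drop_eq : T.drop j = T'.drop off

theorem IsEdit.edited {κ : EditKind} {i : ℕ} {T T' : List α} (h : IsEdit κ i T T') :
    Edited T T' i (κ.off i) (κ.resume i) := by
  cases κ with
  | insertion =>
    obtain ⟨p, s, c, rfl, rfl, rfl⟩ := h
    constructor <;> simp [EditKind.off, EditKind.resume, List.drop_append]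
  | substitution =>
    obtain ⟨p, s, c, d, -, rfl, rfl, rfl⟩ := h
    constructor <;> simp [EditKind.off, EditKind.resume, List.drop_append]
  | deletion =>
    obtain ⟨p, s, d, rfl, rfl, rfl⟩ := h
    constructor <;> simp [EditKind.off, EditKind.resume, List.drop_append]

section Edited

variable {T T' x y : List α} {i off j b b' k n : ℕ} {c : α}

namespace Edited

theorem le_length (h : Edited T T' i off j) : i ≤ T'.length := h.le_off.trans h.off_le_length

theorem getElem?_left (h : Edited T T' i off j) (hk : k < i) : T[k]? = T'[k]? := by
  rw [← List.getElem?_take_of_lt hk, h.take_eq, List.getElem?_take_of_lt hk]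

theorem getElem?_right (h : Edited T T' i off j) (hb : off ≤ b) : T[j + (b - off)]? = T'[b]? := by
  rw [← List.getElem?_drop, h.drop_eq, List.getElem?_drop, Nat.add_sub_cancel' hb]

theorem length_sub_resume (h : Edited T T' i off j) : T.length - j = T'.length - off := by
  simpa using congrArg List.length h.drop_eq

theorem occursAt_left (h : Edited T T' i off j) (hx : OccursAt T' x b) (hb : b + x.length ≤ i) :
    OccursAt T x b := by
  have := h.le_resume
  have := h.resume_le_length
  exact occursAt_iff.2 ⟨by omega, fun k hk => by rw [h.getElem?_left (by omega), hx.getElem? hk]⟩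

theorem occursAt_right (h : Edited T T' i off j) (hx : OccursAt T' x b) (hb : off ≤ b) :
    OccursAt T x (j + (b - off)) := by
  rw [occursAt_iff]
  have := h.length_sub_resume
  have := h.resume_le_length
  have := hx.add_length_le
  refine ⟨by omega, fun k hk => ?_⟩
  rw [← hx.getElem? hk, ← h.getElem?_right (b := b + k) (by omega)]
  congr 1; omega

theorem leftChar_left (h : Edited T T' i off j) (hb : b ≤ i) : leftChar T b = leftChar T' b := by
  unfold leftChar
  split_ifs
  · rfl
  · exact h.getElem?_left (by omega)

theorem leftChar_right (h : Edited T T' i off j) (hb : off < b) :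
    leftChar T (j + (b - off)) = leftChar T' b := by
  rw [leftChar_of_pos (by omega), leftChar_of_pos (by omega), ← h.getElem?_right (by omega)]
  congr 1; omega

theorem rightChar_right (h : Edited T T' i off j) (hb : off ≤ b) :
    T[j + (b - off) + n]? = T'[b + n]? := by
  rw [← h.getElem?_right (by omega)]; congr 1; omega

theorem straddles (h : Edited T T' i off j) (hx : OccursAt T' x b) (hn : ¬ x <:+: T) :
    b < off ∧ i < b + x.length := by
  constructor
  · by_contra hb
    exact hn (h.occursAt_right hx (by omega)).isInfix
  · by_contra hb
    exact hn (h.occursAt_left hx (by omega)).isInfix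

end Edited

/-- The beginnings of the crossing occurrences of `x` in `T'`, in the form in which `crosses_iff`
makes the condition independent of the kind of edit. Unlike `crossPos`, it admits `x = []`. -/
def crossings (i off : ℕ) (T' x : List α) : Set ℕ :=
  {b | OccursAt T' x b ∧ i ≤ b + x.length ∧ b ≤ off}

/-- The beginning of the leftmost crossing occurrence; it is `0` if there is none. -/
noncomputable def firstCrossing (i off : ℕ) (T' x : List α) : ℕ := sInf (crossings i off T' x)

/-- The beginning of the rightmost crossing occurrence; it is `0` if there is none. -/
noncomputable def lastCrossing (i off : ℕ) (T' x : List α) : ℕ := sSup (crossings i off T' x)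

theorem crossPos_eq_crossings {κ : EditKind} (hx : x ≠ []) :
    crossPos κ i T' x = crossings i (κ.off i) T' x := by
  ext b
  have := List.length_pos_iff.2 hx
  simp only [crossPos, crossings, Set.mem_ofPred_eq, crosses_iff (show b < b + x.length by omega),
    ne_eq, hx, not_false_eq_true, true_and]

theorem bddAbove_crossings : BddAbove (crossings i off T' x) := ⟨off, fun _ hb => hb.2.2⟩

theorem firstCrossing_mem (h : (crossings i off T' x).Nonempty) :
    firstCrossing i off T' x ∈ crossings i off T' x := Nat.sInf_mem h

theorem lastCrossing_mem (h : (crossings i off T' x).Nonempty) :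
    lastCrossing i off T' x ∈ crossings i off T' x := Nat.sSup_mem h bddAbove_crossings

theorem firstCrossing_le (h : b ∈ crossings i off T' x) : firstCrossing i off T' x ≤ b :=
  Nat.sInf_le h

theorem le_lastCrossing (h : b ∈ crossings i off T' x) : b ≤ lastCrossing i off T' x :=
  le_csSup bddAbove_crossings h

namespace Edited

theorem rightChar_eq_first (h : Edited T T' i off j) (hb : b ∈ crossings i off T' x)
    (hlt : b < lastCrossing i off T' x) :
    T'[b + x.length]? = T'[firstCrossing i off T' x + x.length]? := by
  rcases (firstCrossing_le hb).eq_or_lt with e | hlt'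
  · rw [e]
  · have h₁ := firstCrossing_mem ⟨b, hb⟩
    have h₃ := lastCrossing_mem ⟨b, hb⟩
    have := h.off_le
    exact (rightChar_eq_of_three h₁.1 hb.1 h₃.1 hlt' hlt
      (by have := h₁.2; have := h₃.2; omega)).symm

theorem leftChar_eq_last (h : Edited T T' i off j) (hb : b ∈ crossings i off T' x)
    (hlt : firstCrossing i off T' x < b) :
    leftChar T' b = leftChar T' (lastCrossing i off T' x) := by
  rcases (le_lastCrossing hb).eq_or_lt with e | hlt'
  · rw [e]
  · have h₁ := firstCrossing_mem ⟨b, hb⟩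
    have h₃ := lastCrossing_mem ⟨b, hb⟩
    have := h.off_le
    exact leftChar_eq_of_three h₁.1 hb.1 h₃.1 hlt hlt' (by have := h₁.2; have := h₃.2; omega)

theorem lt_of_leftChar_ne (h : Edited T T' i off j) (hc : PrecededOnlyBy T x c)
    (hb : OccursAt T' x b) (hx : x ≠ []) (hne : leftChar T' b ≠ some c) : i < b + x.length := by
  by_contra hle
  have := List.length_pos_iff.2 hx
  exact hne (by rw [← h.leftChar_left (by omega), hc _ (h.occursAt_left hb (by omega))])

theorem le_of_leftChar_ne (h : Edited T T' i off j) (hc : PrecededOnlyBy T x c)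
    (hb : OccursAt T' x b) (hne : leftChar T' b ≠ some c) : b ≤ off := by
  by_contra hle
  exact hne (by rw [← h.leftChar_right (by omega), hc _ (h.occursAt_right hb (by omega))])

theorem exists_crossing_leftChar_ne (h : Edited T T' i off j) (hc : PrecededOnlyBy T x c)
    (hx : x ∈ LeftM T') (hne : x ≠ []) :
    ∃ b ∈ crossings i off T' x, i < b + x.length ∧ leftChar T' b ≠ some c := by
  obtain ⟨b, hb, hbc⟩ := exists_leftChar_ne hx c
  have hlt := h.lt_of_leftChar_ne hc hb hne hbc
  exact ⟨b, ⟨hb, hlt.le, h.le_of_leftChar_ne hc hb hbc⟩, hlt, hbc⟩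

theorem leftChar_first_or_last_ne (h : Edited T T' i off j) {o : Option α}
    (hb : b ∈ crossings i off T' x) (hbo : leftChar T' b ≠ o) :
    leftChar T' (firstCrossing i off T' x) ≠ o ∨
      leftChar T' (lastCrossing i off T' x) ≠ o := by
  rcases (firstCrossing_le hb).eq_or_lt with e | hlt
  · exact Or.inl (by rwa [e])
  · exact Or.inr (by rwa [← h.leftChar_eq_last hb hlt])

end Edited

theorem occursAt_cons_of_leftChar {a : α} (h : OccursAt T x b) (ha : leftChar T b = some a) :
    OccursAt T (a :: x) (b - 1) ∧ 0 < b := by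
  rcases b with _ | b
  · simp [leftChar_zero] at ha
  · exact ⟨occursAt_cons.2 ⟨h, leftChar_succ.symm.trans ha⟩, b.succ_pos⟩

theorem leftChar_of_shared_end (hc : PrecededOnlyBy T x c) (hx : OccursAt T' x b)
    (hy : OccursAt T' y b') (hyT : y <:+: T) (he : b + x.length = b' + y.length)
    (hlt : x.length < y.length) : leftChar T' b = some c := by
  obtain ⟨a, ha⟩ := hx.exists_leftChar (by omega)
  obtain ⟨hax, hb⟩ := occursAt_cons_of_leftChar hx ha
  have hsuf : a :: x <:+ y := by
    rw [hax.eq_window, hy.eq_window, List.length_cons, show b - 1 + (x.length + 1) = b' + y.length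
      by omega]
    exact window_suffix_window (by omega)
  obtain ⟨q, hq, hqa⟩ := cons_isInfix_iff.1 (hsuf.isInfix.trans hyT)
  rw [ha, ← hqa, hc q hq]

end Edited

/-! ### Counting windows with a common end point -/

section Windows

variable {ι : Type*} {T T' : List α} {i off j b e : ℕ} {A : Finset ι} {s t : ι → ℕ}

theorem injOn_leftMax_window (hinj : Set.InjOn t A) (hbt : ∀ a ∈ A, b ≤ t a)
    (ht : ∀ a ∈ A, t a ≤ T'.length) (hT : ∀ a ∈ A, window T' b (t a) <:+: T) :
    Set.InjOn (fun a => leftMax T (window T' b (t a))) A := by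
  have hinj' : Set.InjOn (fun a => window T' b (t a)) A := fun a ha a' ha' haa' => hinj ha ha' <| by
    have := congrArg List.length haa'
    rw [length_window (ht a ha), length_window (ht a' ha')] at this
    have := hbt a ha
    have := hbt a' ha'
    omega
  have hchain : IsChain (· <+: ·) ((fun a => window T' b (t a)) '' A) := by
    rintro _ ⟨a, -, rfl⟩ _ ⟨a', -, rfl⟩ -
    exact (le_total (t a) (t a')).imp window_prefix_window window_prefix_window
  exact (injOn_leftMax_of_isChain hchain (by rintro _ ⟨a, ha, rfl⟩; exact hT a ha)).comp hinj'
    (Set.mapsTo_image _ _)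

theorem injOn_rightMax_window (hinj : Set.InjOn s A) (hse : ∀ a ∈ A, s a ≤ e)
    (he : e ≤ T'.length) (hT : ∀ a ∈ A, window T' (s a) e <:+: T) :
    Set.InjOn (fun a => rightMax T (window T' (s a) e)) A := by
  have hinj' : Set.InjOn (fun a => window T' (s a) e) A := fun a ha a' ha' haa' => hinj ha ha' <| by
    have := congrArg List.length haa'
    rw [length_window he, length_window he] at this
    have := hse a ha
    have := hse a' ha'
    omega
  have hchain : IsChain (· <:+ ·) ((fun a => window T' (s a) e) '' A) := by
    rintro _ ⟨a, -, rfl⟩ _ ⟨a', -, rfl⟩ -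
    exact ((le_total (s a) (s a')).imp window_suffix_window window_suffix_window).symm
  exact (injOn_rightMax_of_isChain hchain (by rintro _ ⟨a, ha, rfl⟩; exact hT a ha)).comp hinj'
    (Set.mapsTo_image _ _)

theorem sum_rightDeg_window_le_size (hinj : Set.InjOn t A) (hbt : ∀ a ∈ A, b ≤ t a)
    (ht : ∀ a ∈ A, t a ≤ T'.length) (hR : ∀ a ∈ A, window T' b (t a) ∈ RightM T) :
    ∑ a ∈ A, rightDeg T (window T' b (t a)) ≤ size T := by
  rw [Finset.sum_congr rfl fun a ha => (leftExt_leftMax (hR a ha).1).rightDeg_eq.symm]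
  exact sum_rightDeg_le_size (injOn_leftMax_window hinj hbt ht fun a ha => (hR a ha).1)
    fun a ha => leftMax_mem_maxSub (hR a ha)

theorem Edited.card_le_ncard_mr_of_ends (h : Edited T T' i off j) (hinj : Set.InjOn t A)
    (hoff : ∀ a ∈ A, off ≤ t a) (ht : ∀ a ∈ A, t a < T'.length)
    (hR : ∀ a ∈ A, window T' off (t a) ∈ RightM T) : A.card ≤ (MR T).ncard := by
  refine card_le_ncard_mr (injOn_leftMax_window hinj hoff (fun a ha => (ht a ha).le)
    fun a ha => (hR a ha).1) fun a ha => leftMax_mem_mr (hR a ha) (c := T'[t a]'(ht a ha)) ?_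
  refine (h.occursAt_right (occursAt_append_singleton.2
    ⟨occursAt_window (hoff a ha) (ht a ha).le, ?_⟩) le_rfl).isInfix
  rw [length_window (ht a ha).le, Nat.add_sub_cancel' (hoff a ha)]
  simp

theorem card_le_ncard_maxSub_of_starts (hinj : Set.InjOn s A) (hse : ∀ a ∈ A, s a ≤ e)
    (he : e ≤ T'.length) (hL : ∀ a ∈ A, window T' (s a) e ∈ LeftM T) :
    A.card ≤ (MaxSub T).ncard :=
  Set.ncard_coe_finset A ▸ Set.ncard_le_ncard_of_injOn _
    (fun a ha => rightMax_mem_maxSub (hL a ha))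
    (injOn_rightMax_window hinj hse he fun a ha => (hL a ha).1) (finite_maxSub T)

theorem card_le_ncard_mr_of_starts (hinj : Set.InjOn s A) (hse : ∀ a ∈ A, s a ≤ e)
    (he : e ≤ T'.length) (hL : ∀ a ∈ A, window T' (s a) e ∈ LeftM T)
    (htwice : ∀ a ∈ A, ∃ b b', b ≠ b' ∧ OccursAt T (window T' (s a) e) b ∧
      OccursAt T (window T' (s a) e) b') : A.card ≤ (MR T).ncard := by
  refine card_le_ncard_mr (injOn_rightMax_window hinj hse he fun a ha => (hL a ha).1) fun a ha => ?_
  obtain ⟨b, b', hne, hb, hc⟩ := htwice a ha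
  exact rightMax_mem_mr (hL a ha) hne hb hc

-- A new right-extension is determined by where it begins: of two that begin at the same position,
-- the longer one would contain the other and be a prefix of a substring of `T`.
theorem Edited.card_newRight_le (h : Edited T T' i off j) (F : Finset (List α × α))
    (hT : ∀ q ∈ F, q.1 <:+: T) (hnew : ∀ q ∈ F, ¬ (q.1 ++ [q.2]) <:+: T)
    (hF : ∀ q ∈ F, ∃ b, OccursAt T' (q.1 ++ [q.2]) b ∧ window T' b i ∈ LeftM T) :
    F.card ≤ (MaxSub T).ncard := by
  choose! s hs using hF
  refine card_le_ncard_maxSub_of_starts (s := s) (fun q hq r hr hqr => ?_) (fun q hq => ?_)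
    h.le_length fun q hq => (hs q hq).2
  · have length_le : ∀ q ∈ F, ∀ r ∈ F, s q = s r → q.1.length ≤ r.1.length := by
      intro q hq r hr hqr
      by_contra! hlt
      refine hnew r hr (List.IsInfix.trans ?_ (hT q hq))
      rw [(hs r hr).1.eq_window, (occursAt_append_singleton.1 (hs q hq).1).1.eq_window, hqr]
      exact (window_prefix_window (by simp; omega)).isInfix
    have hl := (length_le q hq r hr hqr).antisymm (length_le r hr q hq hqr.symm)
    have heq := (hs q hq).1.eq_of_length_eq (hqr ▸ (hs r hr).1) (by simp [hl])
    obtain ⟨h₁, h₂⟩ := List.append_inj heq hl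
    exact Prod.ext h₁ (by simpa using h₂)
  · have := (h.straddles (hs q hq).1 (hnew q hq)).1
    have := h.off_le
    omega

end Windows

/-! ### End-markers and new maximal repeats -/

section Marker

variable {d : α} {T T' x : List α} {b k : ℕ}

theorem EndsWithMarker.succ_eq_length (h : EndsWithMarker d T) (hk : T[k]? = some d) :
    k + 1 = T.length := by
  obtain ⟨w, hw, rfl⟩ := h
  have hl := (List.getElem?_eq_some_iff.1 hk).1
  simp only [List.length_append, List.length_singleton] at hl ⊢
  by_contra hne
  rw [List.getElem?_append_left (by omega)] at hk
  exact hw (List.mem_of_getElem? hk)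

theorem EndsWithMarker.mem_of_isSuffix (h : EndsWithMarker d T) (hx : x <:+ T) (hne : x ≠ []) :
    d ∈ x := by
  obtain ⟨w, -, rfl⟩ := h
  obtain ⟨u, hu⟩ := hx
  have := congrArg List.getLast? hu
  rw [List.getLast?_append_of_ne_nil _ hne, List.getLast?_concat] at this
  exact List.mem_of_getLast? this

theorem EndsWithMarker.notMem_of_mem_mr (h : EndsWithMarker d T) (hx : x ∈ MR T) : d ∉ x := by
  intro hd
  obtain ⟨k, hk, hkd⟩ := List.mem_iff_getElem.1 hd
  have occurs_at_end : ∀ b, OccursAt T x b → b + k + 1 = T.length := fun b hb =>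
    h.succ_eq_length (by rw [hb.getElem? hk, ← hkd]; simp)
  obtain ⟨⟨hL, -⟩, hne⟩ := hx
  obtain ⟨b, hb⟩ := isInfix_iff_exists_occursAt.1 hL.1
  rcases eq_or_ne b 0 with rfl | hb0
  · have := occurs_at_end _ hb
    exact hne ((isPrefix_iff_occursAt_zero.2 hb).eq_of_length_le (by omega))
  · obtain ⟨c, hc⟩ := hb.exists_leftChar hb0
    obtain ⟨b', hb', hne'⟩ := exists_leftChar_ne hL c
    have := occurs_at_end _ hb
    have := occurs_at_end _ hb'
    obtain rfl : b = b' := by omega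
    exact hne' hc

theorem ne_nil_of_mem_n (hx : x ∈ N T T') : x ≠ [] := by
  rintro rfl
  exact hx.1.2 (nil_mem_maxSub T)

theorem mem_mr_of_mem_n (hx : x ∈ N T T') : x ∈ MR T' := ⟨hx.1.1, hx.2⟩

theorem not_isSuffix_of_mem_n (hT' : EndsWithMarker d T') (hx : x ∈ N T T') : ¬ x <:+ T' :=
  fun h => hT'.notMem_of_mem_mr (mem_mr_of_mem_n hx) (hT'.mem_of_isSuffix h (ne_nil_of_mem_n hx))

theorem exists_rightChar_of_mem_n (hT' : EndsWithMarker d T') (hx : x ∈ N T T')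
    (hb : OccursAt T' x b) : ∃ a, T'[b + x.length]? = some a := by
  refine Option.ne_none_iff_exists'.1 fun hnone => ?_
  exact not_isSuffix_of_mem_n hT' hx (isSuffix_iff_exists_occursAt.2 ⟨b, hb, hnone⟩)

theorem two_le_rightDeg_of_mem_n (hT' : EndsWithMarker d T') (hx : x ∈ N T T') :
    2 ≤ rightDeg T' x := by
  obtain ⟨a, b, hab, ha, hb⟩ := hx.1.1.2.2.resolve_right (not_isSuffix_of_mem_n hT' hx)
  exact (Set.one_lt_ncard (finite_rightChars T' x)).2 ⟨a, ha, b, hb, hab⟩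

theorem mem_n₃_iff : x ∈ N₃ T T' ↔ x ∈ N T T' ∧ x ∉ LeftM T ∧ x ∉ RightM T := by
  simp only [N₃, N₁, N₂, Set.mem_sdiff, Set.mem_union, Set.mem_inter_iff]
  tauto

end Marker

/-! ### Additional maximal repeats -/

section Additional

variable {d : α} {κ : EditKind} {T T' x : List α} {i off j b : ℕ} {a c : α}

/-- The members `x` of `Nadd`, with the first condition in its definition, which holds for all of
`N₃`, left out, and the second one stated in terms of `crossings`. -/
structure IsAdd (T T' : List α) (i off : ℕ) (x : List α) : Prop where
  mem_n : x ∈ N T T'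
  notMem_leftM : x ∉ LeftM T
  notMem_rightM : x ∉ RightM T
  exists_crossing : ∀ a ∈ rightChars T' x, ∃ b ∈ crossings i off T' x, T'[b + x.length]? = some a

theorem mem_nadd_iff : x ∈ Nadd κ i T T' ↔ IsAdd T T' i (κ.off i) x := by
  constructor
  · rintro ⟨h₃, -, hcross⟩
    obtain ⟨hN, hL, hR⟩ := mem_n₃_iff.1 h₃
    refine ⟨hN, hL, hR, fun a ha => ?_⟩
    obtain ⟨b, hb, ho⟩ := hcross a ha
    exact ⟨b, crossPos_eq_crossings (ne_nil_of_mem_n hN) ▸ hb, (occursAt_append_singleton.1 ho).2⟩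
  · rintro ⟨hN, hL, hR, hcross⟩
    refine ⟨mem_n₃_iff.2 ⟨hN, hL, hR⟩, fun _ => mem_mr_of_mem_n hN, fun a ha => ?_⟩
    obtain ⟨b, hb, ho⟩ := hcross a ha
    exact ⟨b, crossPos_eq_crossings (ne_nil_of_mem_n hN) ▸ hb,
      occursAt_append_singleton.2 ⟨hb.1, ho⟩⟩

theorem window_prefix_of_mem_crossings (hb : b ∈ crossings i off T' x) : window T' b i <+: x := by
  conv_rhs => rw [hb.1.eq_window]
  exact window_prefix_window hb.2.1

namespace Edited

theorem occursAt_window_left (h : Edited T T' i off j) (hb : b ≤ i) :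
    OccursAt T (window T' b i) b :=
  h.occursAt_left (occursAt_window hb h.le_length) (by rw [length_window h.le_length]; omega)

theorem window_mem_leftM (h : Edited T T' i off j) (hx : x <:+: T) (hc : PrecededOnlyBy T x c)
    (hb : b ∈ crossings i off T' x) (hbi : b ≤ i) (hbc : leftChar T' b ≠ some c) :
    window T' b i ∈ LeftM T := by
  obtain ⟨q, hq⟩ := isInfix_iff_exists_occursAt.1 hx
  refine mem_leftM_of_leftChar_ne (h.occursAt_window_left hbi)
    (hq.of_prefix (window_prefix_of_mem_crossings hb)) ?_
  rwa [h.leftChar_left hbi, hc q hq]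

end Edited

namespace IsAdd

theorem nonempty_crossings (hx : IsAdd T T' i off x) (hT' : EndsWithMarker d T') :
    (crossings i off T' x).Nonempty := by
  have := two_le_rightDeg_of_mem_n hT' hx.mem_n
  obtain ⟨a, ha⟩ : (rightChars T' x).Nonempty :=
    Set.nonempty_of_ncard_ne_zero (by unfold rightDeg at this; omega)
  obtain ⟨b, hb, -⟩ := hx.exists_crossing a ha
  exact ⟨b, hb⟩

theorem first_mem (hx : IsAdd T T' i off x) (hT' : EndsWithMarker d T') :
    firstCrossing i off T' x ∈ crossings i off T' x :=
  firstCrossing_mem (hx.nonempty_crossings hT')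

theorem last_mem (hx : IsAdd T T' i off x) (hT' : EndsWithMarker d T') :
    lastCrossing i off T' x ∈ crossings i off T' x :=
  lastCrossing_mem (hx.nonempty_crossings hT')

theorem rightChar_first_or_last (hx : IsAdd T T' i off x) (h : Edited T T' i off j)
    (ha : a ∈ rightChars T' x) : T'[firstCrossing i off T' x + x.length]? = some a ∨
      T'[lastCrossing i off T' x + x.length]? = some a := by
  obtain ⟨b, hb, e⟩ := hx.exists_crossing a ha
  rcases (le_lastCrossing hb).eq_or_lt with e' | hlt
  · exact Or.inr (by rw [← e', e])
  · exact Or.inl (by rw [← h.rightChar_eq_first hb hlt, e])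

theorem rightDeg_le_two (hx : IsAdd T T' i off x) (h : Edited T T' i off j)
    (hT' : EndsWithMarker d T') : rightDeg T' x ≤ 2 := by
  obtain ⟨a, ha⟩ := exists_rightChar_of_mem_n hT' hx.mem_n (hx.first_mem hT').1
  obtain ⟨c, hc⟩ := exists_rightChar_of_mem_n hT' hx.mem_n (hx.last_mem hT').1
  have hsub : rightChars T' x ⊆ {a, c} := fun z hz =>
    (hx.rightChar_first_or_last h hz).imp
      (fun e => Option.some_injective _ (e.symm.trans ha))
      (fun e => Option.some_injective _ (e.symm.trans hc))
  exact (Set.ncard_le_ncard hsub).trans ((Set.ncard_insert_le a {c}).trans (by simp))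

theorem rightChar_first_ne_last (hx : IsAdd T T' i off x) (h : Edited T T' i off j)
    (hT' : EndsWithMarker d T') : T'[firstCrossing i off T' x + x.length]? ≠
      T'[lastCrossing i off T' x + x.length]? := by
  intro he
  obtain ⟨a, ha, c, hc, hac⟩ :=
    (Set.one_lt_ncard (finite_rightChars T' x)).1 (two_le_rightDeg_of_mem_n hT' hx.mem_n)
  have ha' := hx.rightChar_first_or_last h ha
  have hc' := hx.rightChar_first_or_last h hc
  rw [he, or_self] at ha' hc'
  exact hac (Option.some_injective _ (ha'.symm.trans hc'))

theorem first_lt_last (hx : IsAdd T T' i off x) (h : Edited T T' i off j)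
    (hT' : EndsWithMarker d T') : firstCrossing i off T' x < lastCrossing i off T' x :=
  (firstCrossing_le (hx.last_mem hT')).lt_of_ne fun e =>
    hx.rightChar_first_ne_last h hT' (by rw [e])

theorem first_le (hx : IsAdd T T' i off x) (h : Edited T T' i off j)
    (hT' : EndsWithMarker d T') : firstCrossing i off T' x ≤ i := by
  have := hx.first_lt_last h hT'
  have := (hx.last_mem hT').2.2
  have := h.off_le
  omega

-- The first crossing occurrence lies further left, so the part of `x` that it has before `i` is
-- longer than that of the last one.
theorem occursAt_window_last_first (hx : IsAdd T T' i off x) (h : Edited T T' i off j)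
    (hT' : EndsWithMarker d T') :
    OccursAt T (window T' (lastCrossing i off T' x) i) (firstCrossing i off T' x) := by
  have := hx.first_lt_last h hT'
  have := hx.first_le h hT'
  refine h.occursAt_left ((hx.first_mem hT').1.of_prefix
    (window_prefix_of_mem_crossings (hx.last_mem hT'))) ?_
  rw [length_window h.le_length]
  omega

theorem window_last_mem_leftM (hx : IsAdd T T' i off x) (h : Edited T T' i off j)
    (hT' : EndsWithMarker d T') (hle : lastCrossing i off T' x ≤ i)
    (hne : leftChar T' (firstCrossing i off T' x) ≠ leftChar T' (lastCrossing i off T' x)) :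
    window T' (lastCrossing i off T' x) i ∈ LeftM T := by
  refine mem_leftM_of_leftChar_ne (hx.occursAt_window_last_first h hT')
    (h.occursAt_window_left hle) ?_
  rwa [h.leftChar_left (hx.first_le h hT'), h.leftChar_left hle]

end IsAdd

/-- The additional maximal repeats that occur in `T`, and whose first crossing occurrence is
preceded, and whose last crossing occurrence is followed, by the same character as all occurrences
in `T`. They escape the charging of `IsAdd.newRightChars_nonempty`. -/
structure IsKept (T T' : List α) (i off : ℕ) (x : List α) : Prop where
  isAdd : IsAdd T T' i off x
  isInfix : x <:+: T
  leftChar_first : ∀ c, PrecededOnlyBy T x c → leftChar T' (firstCrossing i off T' x) = some c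
  rightChar_last :
    ∀ a, FollowedOnlyBy T x a → T'[lastCrossing i off T' x + x.length]? = some a

theorem FollowedOnlyBy.not_isInfix (h : FollowedOnlyBy T x c) (hne : a ≠ c) :
    ¬ (x ++ [a]) <:+: T := fun ha => by
  obtain ⟨b, hb, e⟩ := append_singleton_isInfix_iff.1 ha
  exact hne (Option.some_injective _ (e.symm.trans (h b hb)))

/-- The right-extensions of `x` that are new in `T'` and, up to the edited position, begin with a
left-maximal substring of `T`, which is charged for them. -/
def newRightChars (T T' : List α) (i : ℕ) (x : List α) : Set α :=
  {a | ¬ (x ++ [a]) <:+: T ∧ ∃ b, OccursAt T' (x ++ [a]) b ∧ window T' b i ∈ LeftM T}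

theorem newRightChars_subset : newRightChars T T' i x ⊆ rightChars T' x :=
  fun _ ⟨_, _, hb, _⟩ => hb.isInfix

theorem finite_newRightChars : (newRightChars T T' i x).Finite :=
  (finite_rightChars T' x).subset newRightChars_subset

theorem IsAdd.newRightChars_nonempty (hx : IsAdd T T' i off x) (h : Edited T T' i off j)
    (hT' : EndsWithMarker d T') (hxT : x <:+: T) (hK : ¬ IsKept T T' i off x) :
    (newRightChars T T' i x).Nonempty := by
  obtain ⟨c, hc⟩ := exists_precededOnlyBy hxT hx.notMem_leftM
  obtain ⟨a, ha⟩ := exists_followedOnlyBy hxT hx.notMem_rightM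
  have hF := hx.first_mem hT'
  have hL := hx.last_mem hT'
  obtain ⟨aF, haF⟩ := exists_rightChar_of_mem_n hT' hx.mem_n hF.1
  obtain ⟨aL, haL⟩ := exists_rightChar_of_mem_n hT' hx.mem_n hL.1
  have hne := hx.rightChar_first_ne_last h hT'
  have hFi := hx.first_le h hT'
  obtain rfl | haLa := eq_or_ne aL a
  · refine ⟨aF, ha.not_isInfix fun e => hne (by rw [haF, haL, e]), _,
      occursAt_append_singleton.2 ⟨hF.1, haF⟩, h.window_mem_leftM hxT hc hF hFi fun hcF => ?_⟩
    refine hK ⟨hx, hxT, fun c' hc' => ?_, fun a' ha' => ?_⟩ <;>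
      obtain ⟨q, hq⟩ := isInfix_iff_exists_occursAt.1 hxT
    · rw [hcF, ← hc q hq, hc' q hq]
    · rw [haL, ← ha q hq, ha' q hq]
  · have hnew := ha.not_isInfix haLa
    have hocc := occursAt_append_singleton.2 ⟨hL.1, haL⟩
    refine ⟨aL, hnew, _, hocc, ?_⟩
    have hLi : lastCrossing i off T' x ≤ i := by
      have := (h.straddles hocc hnew).1; have := h.off_le; omega
    by_cases hl : leftChar T' (firstCrossing i off T' x) = leftChar T' (lastCrossing i off T' x)
    · obtain ⟨b, hb, -, hbc⟩ :=
        h.exists_crossing_leftChar_ne hc hx.mem_n.1.1.1 (ne_nil_of_mem_n hx.mem_n)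
      have hLc := h.leftChar_first_or_last_ne hb hbc
      rw [hl, or_self] at hLc
      exact h.window_mem_leftM hxT hc hL hLi hLc
    · exact hx.window_last_mem_leftM h hT' hLi hl

namespace Edited

theorem sum_newRightChars_le (h : Edited T T' i off j) (S : Finset (List α))
    (hS : ∀ x ∈ S, x <:+: T) : ∑ x ∈ S, (newRightChars T T' i x).ncard ≤ (MaxSub T).ncard := by
  have hF := h.card_newRight_le ((S.sigma fun x =>
    (finite_newRightChars (T := T) (T' := T') (i := i) (x := x)).toFinset).map
      (Equiv.sigmaEquivProd (List α) α).toEmbedding)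
  simp only [Finset.forall_mem_map, Finset.mem_sigma, Set.Finite.mem_toFinset] at hF
  rw [Finset.card_map, Finset.card_sigma] at hF
  simp only [Set.ncard_eq_toFinset_card _ finite_newRightChars]
  exact hF (fun q hq => hS q.1 hq.1) (fun q hq => hq.2.1) fun q hq => hq.2.2

theorem rightDeg_le_add_newRightChars (h : Edited T T' i off j) (hx : x ∈ LeftM T) :
    rightDeg T' x ≤ rightDeg T x + (newRightChars T T' i x).ncard := by
  have hsub : rightChars T' x ⊆ rightChars T x ∪ newRightChars T T' i x := fun a ha => by
    refine or_iff_not_imp_left.2 fun hnew => ?_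
    obtain ⟨b, hb⟩ := isInfix_iff_exists_occursAt.1 ha
    refine ⟨hnew, b, hb, mem_leftM_of_prefix hx (window_prefix_of_mem_crossings (off := off) ?_)⟩
    have := h.straddles hb hnew
    simp only [List.length_append, List.length_singleton] at this
    exact ⟨(occursAt_append_singleton.1 hb).1, by omega, by omega⟩
  exact (Set.ncard_le_ncard hsub ((finite_rightChars T x).union finite_newRightChars)).trans
    (Set.ncard_union_le _ _)

theorem sum_rightDeg_le (h : Edited T T' i off j) (hT' : EndsWithMarker d T')
    {S A Q : Finset (List α)} (hS : ∀ x ∈ S, x ∈ MaxSub T) (hA : ∀ x ∈ A, x ∈ N₂ T T')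
    (hQ : ∀ x ∈ Q, IsAdd T T' i off x ∧ x <:+: T ∧ ¬ IsKept T T' i off x) :
    ∑ x ∈ S, rightDeg T' x + ∑ x ∈ A, rightDeg T' x + Q.card ≤
      size T + A.card + (MaxSub T).ncard := by
  classical
  have sum_S : ∑ x ∈ S, rightDeg T' x ≤ size T + ∑ x ∈ S, (newRightChars T T' i x).ncard := by
    refine le_trans ?_ (Nat.add_le_add_right (sum_rightDeg_le_size (Set.injOn_id _) hS) _)
    rw [← Finset.sum_add_distrib]
    exact Finset.sum_le_sum fun x hx => h.rightDeg_le_add_newRightChars (hS x hx).1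
  have sum_A : ∑ x ∈ A, rightDeg T' x ≤ A.card + ∑ x ∈ A, (newRightChars T T' i x).ncard := by
    rw [Finset.card_eq_sum_ones, ← Finset.sum_add_distrib]
    refine Finset.sum_le_sum fun x hx => ?_
    have hR : x ∉ RightM T := fun hR => (hA x hx).1.1.2 ⟨(hA x hx).2, hR⟩
    exact (h.rightDeg_le_add_newRightChars (hA x hx).2).trans
      (Nat.add_le_add_right (rightDeg_le_one hR) _)
  have card_Q : Q.card ≤ ∑ x ∈ Q, (newRightChars T T' i x).ncard := by
    rw [Finset.card_eq_sum_ones]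
    exact Finset.sum_le_sum fun x hx => (Set.ncard_pos finite_newRightChars).2
      ((hQ x hx).1.newRightChars_nonempty h hT' (hQ x hx).2.1 (hQ x hx).2.2)
  have hSA : Disjoint S A := Finset.disjoint_left.2 fun x hx hx' => (hA x hx').1.1.2 (hS x hx)
  have hSAQ : Disjoint (S ∪ A) Q := Finset.disjoint_left.2 fun x hx hx' =>
    (hQ x hx').1.notMem_leftM <|
      (Finset.mem_union.1 hx).elim (fun hx => (hS x hx).1) fun hx => (hA x hx).2
  have hsum := h.sum_newRightChars_le (S ∪ A ∪ Q) fun x hx => by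
    simp only [Finset.mem_union] at hx
    rcases hx with (hx | hx) | hx
    exacts [(hS x hx).1.1, (hA x hx).2.1, (hQ x hx).2.1]
  rw [Finset.sum_union hSAQ, Finset.sum_union hSA] at hsum
  omega

end Edited

end Additional

/-! ### Basic repeats -/

section Basic

variable {d : α} {κ : EditKind} {T T' x y : List α} {i off j b b' : ℕ} {a c : α}

/-- The members of `N₁ ∪ Nbase`, see `isBase_of_mem`: in place of non-membership in `Nadd`,
it is recorded that some right-extension in `T` is not one of a crossing occurrence. -/
structure IsBase (T T' : List α) (i off : ℕ) (x : List α) : Prop where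
  mem_n : x ∈ N T T'
  notMem_leftM : x ∉ LeftM T
  isInfix : x <:+: T
  right : x ∈ RightM T ∨
    ∃ a ∈ rightChars T x, ∀ b ∈ crossings i off T' x, T'[b + x.length]? ≠ some a

/-- The crossing occurrence of `x` at `b` ends at or after `off`, no longer substring of `T` ends
there in `T'`, and the part of `x` from `off` on is right-maximal in `T`. Distinct substrings of
`T` with such occurrences are charged to distinct maximal repeats of `T`. -/
structure NewEnd (T T' : List α) (i off : ℕ) (x : List α) (b : ℕ) : Prop where
  mem_crossings : b ∈ crossings i off T' x
  off_le : off ≤ b + x.length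
  length_le : ∀ y b', y <:+: T → OccursAt T' y b' → b + x.length = b' + y.length →
    y.length ≤ x.length
  mem_rightM : window T' off (b + x.length) ∈ RightM T

theorem window_suffix_of_mem_crossings (hb : b ∈ crossings i off T' x) :
    window T' off (b + x.length) <:+ x := by
  conv_rhs => rw [hb.1.eq_window]
  exact window_suffix_window hb.2.2

theorem NewEnd.eq_of_end_eq (hx : NewEnd T T' i off x b) (hy : NewEnd T T' i off y b')
    (hxT : x <:+: T) (hyT : y <:+: T) (he : b + x.length = b' + y.length) : x = y := by
  have h₁ := hx.length_le y b' hyT hy.mem_crossings.1 he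
  have h₂ := hy.length_le x b hxT hx.mem_crossings.1 he.symm
  obtain rfl : b = b' := by omega
  exact hx.mem_crossings.1.eq_of_length_eq hy.mem_crossings.1 (by omega)

namespace Edited

theorem newEnd_of_leftChar_ne (h : Edited T T' i off j) (hc : PrecededOnlyBy T x c)
    (hb : b ∈ crossings i off T' x) (hx : x ≠ []) (hne : leftChar T' b ≠ some c)
    (hR : off ≤ b + x.length → window T' off (b + x.length) ∈ RightM T) :
    NewEnd T T' i off x b := by
  have hoff : off ≤ b + x.length := by
    have := h.lt_of_leftChar_ne hc hb.1 hx hne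
    have := h.off_le
    omega
  refine ⟨hb, hoff, fun y b' hy hyb he => ?_, hR hoff⟩
  by_contra hlt
  exact hne (leftChar_of_shared_end hc hb.1 hyb hy he (by omega))

theorem isInfix_of_forall_crossing_ne (h : Edited T T' i off j) (ha : (x ++ [a]) <:+: T')
    (hn : ∀ b ∈ crossings i off T' x, T'[b + x.length]? ≠ some a) : (x ++ [a]) <:+: T := by
  by_contra hT
  obtain ⟨b, hb⟩ := isInfix_iff_exists_occursAt.1 ha
  have hstr := h.straddles hb hT
  simp only [List.length_append, List.length_singleton] at hstr
  obtain ⟨hbx, hba⟩ := occursAt_append_singleton.1 hb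
  exact hn b ⟨hbx, by omega, by omega⟩ hba

theorem window_mem_rightM (h : Edited T T' i off j) (hb : b ∈ crossings i off T' x)
    (he : off ≤ b + x.length) (ha : a ∈ rightChars T x) (hc : T'[b + x.length]? = some c)
    (hne : a ≠ c) : window T' off (b + x.length) ∈ RightM T := by
  obtain ⟨q, hq, hqa⟩ := append_singleton_isInfix_iff.1
    (rightChars_subset_of_suffix (window_suffix_of_mem_crossings hb) ha)
  have hw := occursAt_window he hb.1.add_length_le
  refine mem_rightM_of_rightChar_ne hq (h.occursAt_right hw le_rfl) ?_
  rw [hqa, h.rightChar_right le_rfl, length_window hb.1.add_length_le, Nat.add_sub_cancel' he, hc]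
  exact fun e => hne (Option.some_injective _ e)

theorem isBase_of_mem (h : Edited T T' i (κ.off i) j) (hx : x ∈ N₁ T T' ∪ Nbase κ i T T') :
    IsBase T T' i (κ.off i) x := by
  rcases hx with ⟨hN, hR⟩ | ⟨h₃, hadd⟩
  · exact ⟨hN, fun hL => hN.1.2 ⟨hL, hR⟩, hR.1, Or.inl hR⟩
  · obtain ⟨hN, hL, hR⟩ := mem_n₃_iff.1 h₃
    rw [mem_nadd_iff] at hadd
    obtain ⟨a, ha, hn⟩ : ∃ a ∈ rightChars T' x,
        ∀ b ∈ crossings i (κ.off i) T' x, T'[b + x.length]? ≠ some a := by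
      by_contra! hne
      exact hadd ⟨hN, hL, hR, hne⟩
    have haT := h.isInfix_of_forall_crossing_ne ha hn
    exact ⟨hN, hL, (List.prefix_append x [a]).isInfix.trans haT, Or.inr ⟨a, haT, hn⟩⟩

end Edited

theorem IsBase.window_mem_rightM (hx : IsBase T T' i off x) (h : Edited T T' i off j)
    (hT' : EndsWithMarker d T') (hb : b ∈ crossings i off T' x) (he : off ≤ b + x.length) :
    window T' off (b + x.length) ∈ RightM T := by
  rcases hx.right with hR | ⟨a, ha, hn⟩
  · exact mem_rightM_of_suffix hR (window_suffix_of_mem_crossings hb)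
  · obtain ⟨c, hc⟩ := exists_rightChar_of_mem_n hT' hx.mem_n hb.1
    exact h.window_mem_rightM hb he ha hc fun e => hn b hb (by rw [hc, e])

theorem IsBase.exists_newEnd (hx : IsBase T T' i off x) (h : Edited T T' i off j)
    (hT' : EndsWithMarker d T') :
    ∃ b, (b = firstCrossing i off T' x ∨ b = lastCrossing i off T' x) ∧
      NewEnd T T' i off x b := by
  obtain ⟨c, hc⟩ := exists_precededOnlyBy hx.isInfix hx.notMem_leftM
  have hnil := ne_nil_of_mem_n hx.mem_n
  obtain ⟨b, hb, -, hbc⟩ := h.exists_crossing_leftChar_ne hc hx.mem_n.1.1.1 hnil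
  have newEnd : ∀ b ∈ crossings i off T' x, leftChar T' b ≠ some c → NewEnd T T' i off x b :=
    fun b hb hne => h.newEnd_of_leftChar_ne hc hb hnil hne (hx.window_mem_rightM h hT' hb)
  rcases h.leftChar_first_or_last_ne hb hbc with hne | hne
  exacts [⟨_, Or.inl rfl, newEnd _ (firstCrossing_mem ⟨b, hb⟩) hne⟩,
    ⟨_, Or.inr rfl, newEnd _ (lastCrossing_mem ⟨b, hb⟩) hne⟩]

-- The last crossing occurrence lies further right, so the part of `x` that it has after `off` is
-- longer than that of the first one.
theorem IsAdd.window_first_mem_rightM (hx : IsAdd T T' i off x) (h : Edited T T' i off j)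
    (hT' : EndsWithMarker d T') (he : off ≤ firstCrossing i off T' x + x.length) :
    window T' off (firstCrossing i off T' x + x.length) ∈ RightM T := by
  have hF := hx.first_mem hT'
  have hlt := hx.first_lt_last h hT'
  have hlen := length_window (b := off) hF.1.add_length_le
  have hw := occursAt_window he hF.1.add_length_le
  have hw' := (hx.last_mem hT').1.of_suffix (window_suffix_of_mem_crossings hF)
  have := hF.2.2
  refine mem_rightM_of_rightChar_ne (h.occursAt_right hw le_rfl)
    (h.occursAt_right hw' (by omega)) ?_
  rw [h.rightChar_right le_rfl, h.rightChar_right (by omega), hlen, Nat.add_sub_cancel' he,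
    add_assoc, Nat.sub_add_cancel (by omega)]
  exact hx.rightChar_first_ne_last h hT'

theorem IsAdd.exists_newEnd (hx : IsAdd T T' i off x) (h : Edited T T' i off j)
    (hT' : EndsWithMarker d T') (hxT : x <:+: T) (hK : ¬ IsKept T T' i off x) :
    ∃ b, NewEnd T T' i off x b := by
  obtain ⟨c, hc⟩ := exists_precededOnlyBy hxT hx.notMem_leftM
  have hnil := ne_nil_of_mem_n hx.mem_n
  by_cases hl : leftChar T' (firstCrossing i off T' x) = some c
  · obtain ⟨b, hb, -, hbc⟩ := h.exists_crossing_leftChar_ne hc hx.mem_n.1.1.1 hnil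
    have hLc := (h.leftChar_first_or_last_ne hb hbc).resolve_left (not_not_intro hl)
    have hL := hx.last_mem hT'
    refine ⟨_, h.newEnd_of_leftChar_ne hc hL hnil hLc fun hoff => ?_⟩
    obtain ⟨a, ha⟩ := exists_followedOnlyBy hxT hx.notMem_rightM
    obtain ⟨aL, haL⟩ := exists_rightChar_of_mem_n hT' hx.mem_n hL.1
    obtain ⟨q, hq⟩ := isInfix_iff_exists_occursAt.1 hxT
    refine h.window_mem_rightM hL hoff (append_singleton_isInfix_iff.2 ⟨q, hq, ha q hq⟩) haL
      fun e => hK ⟨hx, hxT, fun c' hc' => ?_, fun a' ha' => ?_⟩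
    · rw [hl, ← hc q hq, hc' q hq]
    · rw [haL, ← e, ← ha q hq, ha' q hq]
  · exact ⟨_, h.newEnd_of_leftChar_ne hc (hx.first_mem hT') hnil hl
      (hx.window_first_mem_rightM h hT')⟩

theorem Edited.card_add_card_le (h : Edited T T' i off j) (hT' : EndsWithMarker d T')
    {B Q : Finset (List α)} (hB : ∀ x ∈ B, IsBase T T' i off x) (hBQ : Disjoint B Q)
    (hQ : ∀ x ∈ Q, IsAdd T T' i off x ∧ x <:+: T ∧ ¬ IsKept T T' i off x) :
    B.card + Q.card ≤ (MR T).ncard := by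
  classical
  have exists_end : ∀ x ∈ B ∪ Q, ∃ b, x ∈ N T T' ∧ x <:+: T ∧ NewEnd T T' i off x b := by
    intro x hx
    rcases Finset.mem_union.1 hx with hx | hx
    · obtain ⟨b, -, hb⟩ := (hB x hx).exists_newEnd h hT'
      exact ⟨b, (hB x hx).mem_n, (hB x hx).isInfix, hb⟩
    · obtain ⟨b, hb⟩ := (hQ x hx).1.exists_newEnd h hT' (hQ x hx).2.1 (hQ x hx).2.2
      exact ⟨b, (hQ x hx).1.mem_n, (hQ x hx).2.1, hb⟩
  choose! s hN hT hs using exists_end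
  rw [← Finset.card_union_of_disjoint hBQ]
  refine h.card_le_ncard_mr_of_ends (t := fun x => s x + x.length)
    (fun x hx y hy => (hs x hx).eq_of_end_eq (hs y hy) (hT x hx) (hT y hy))
    (fun x hx => (hs x hx).off_le) (fun x hx => ?_) fun x hx => (hs x hx).mem_rightM
  obtain ⟨a, ha⟩ := exists_rightChar_of_mem_n hT' (hN x hx) (hs x hx).mem_crossings.1
  exact (List.getElem?_eq_some_iff.1 ha).1

theorem Edited.rightDeg_le_add_two (h : Edited T T' i off j) (hT' : EndsWithMarker d T')
    (hx : x ∈ N T T') (hb : b ∈ crossings i off T' x) : rightDeg T' x ≤ rightDeg T x + 2 := by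
  obtain ⟨aF, haF⟩ := exists_rightChar_of_mem_n hT' hx (firstCrossing_mem ⟨b, hb⟩).1
  obtain ⟨aL, haL⟩ := exists_rightChar_of_mem_n hT' hx (lastCrossing_mem ⟨b, hb⟩).1
  have hsub : rightChars T' x ⊆ rightChars T x ∪ {aF, aL} := by
    refine fun a ha => or_iff_not_imp_left.2 fun haT => ?_
    obtain ⟨q, hq, e⟩ : ∃ q ∈ crossings i off T' x, T'[q + x.length]? = some a := by
      by_contra! hn
      exact haT (h.isInfix_of_forall_crossing_ne ha hn)
    rcases (le_lastCrossing hq).eq_or_lt with e' | hlt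
    · exact Or.inr (Option.some_injective _ (by rw [← e, e', haL]))
    · exact Or.inl (Option.some_injective _ (by rw [← e, h.rightChar_eq_first hq hlt, haF]))
  calc rightDeg T' x
      ≤ (rightChars T x ∪ {aF, aL}).ncard :=
        Set.ncard_le_ncard hsub ((finite_rightChars T x).union (by simp))
    _ ≤ rightDeg T x + ({aF, aL} : Set α).ncard := Set.ncard_union_le _ _
    _ ≤ rightDeg T x + 2 :=
        Nat.add_le_add_left ((Set.ncard_insert_le aF {aL}).trans (by simp)) _

/-! ### Associated strings -/

/-- `x` has a crossing occurrence at `b`, and it is the leftmost or the rightmost one. -/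
def IsOuterCrossing (i off : ℕ) (T' x : List α) (b : ℕ) : Prop :=
  b ∈ crossings i off T' x ∧ (b = firstCrossing i off T' x ∨ b = lastCrossing i off T' x)

theorem sLeft_eq_window (hx : x ≠ []) :
    sLeft κ i T' x = window T' i (firstCrossing i (κ.off i) T' x + x.length) := by
  unfold sLeft
  rw [crossPos_eq_crossings hx]
  rfl

theorem sRight_eq_window (hx : x ≠ []) :
    sRight κ i T' x = window T' i (lastCrossing i (κ.off i) T' x + x.length) := by
  unfold sRight
  rw [crossPos_eq_crossings hx]
  rfl

theorem window_end_eq_iff (hb : b ∈ crossings i off T' x) (hb' : b' ∈ crossings i off T' y) :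
    window T' i (b + x.length) = window T' i (b' + y.length) ↔ b + x.length = b' + y.length := by
  refine ⟨fun e => ?_, fun e => by rw [e]⟩
  have hlen := congrArg List.length e
  rw [length_window hb.1.add_length_le, length_window hb'.1.add_length_le] at hlen
  have := hb.2.1
  have := hb'.2.1
  omega

theorem sLeft_eq_sLeft_or_sRight_iff (hx : x ≠ []) (hy : y ≠ [])
    (hxc : (crossings i (κ.off i) T' x).Nonempty) (hyc : (crossings i (κ.off i) T' y).Nonempty) :
    (sLeft κ i T' x = sLeft κ i T' y ∨ sLeft κ i T' x = sRight κ i T' y) ↔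
      ∃ b, IsOuterCrossing i (κ.off i) T' y b ∧
        firstCrossing i (κ.off i) T' x + x.length = b + y.length := by
  have hF := firstCrossing_mem hyc
  have hL := lastCrossing_mem hyc
  rw [sLeft_eq_window hx, sLeft_eq_window hy, sRight_eq_window hy,
    window_end_eq_iff (firstCrossing_mem hxc) hF, window_end_eq_iff (firstCrossing_mem hxc) hL]
  constructor
  · rintro (e | e)
    exacts [⟨_, ⟨hF, Or.inl rfl⟩, e⟩, ⟨_, ⟨hL, Or.inr rfl⟩, e⟩]
  · rintro ⟨b, ⟨-, rfl | rfl⟩, e⟩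
    exacts [Or.inl e, Or.inr e]

/-- The outer crossing occurrence of `x` at `b` does not end where one of a longer member of
`N₁ ∪ Nbase` ends. -/
structure OwnEnd (κ : EditKind) (i : ℕ) (T T' x : List α) (b : ℕ) : Prop where
  isOuterCrossing : IsOuterCrossing i (κ.off i) T' x b
  length_le : ∀ y ∈ N₁ T T' ∪ Nbase κ i T T', ∀ b', IsOuterCrossing i (κ.off i) T' y b' →
    b + x.length = b' + y.length → y.length ≤ x.length

theorem OwnEnd.eq_of_end_eq (hx : x ∈ N₁ T T' ∪ Nbase κ i T T')
    (hy : y ∈ N₁ T T' ∪ Nbase κ i T T') (hb : OwnEnd κ i T T' x b) (hb' : OwnEnd κ i T T' y b')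
    (he : b + x.length = b' + y.length) : x = y := by
  have h₁ := hb.length_le y hy b' hb'.isOuterCrossing he
  have h₂ := hb'.length_le x hx b hb.isOuterCrossing he.symm
  obtain rfl : b = b' := by omega
  exact hb.isOuterCrossing.1.1.eq_of_length_eq hb'.isOuterCrossing.1.1 (by omega)

namespace Edited

theorem nonempty_crossings (h : Edited T T' i (κ.off i) j) (hT' : EndsWithMarker d T')
    (hx : x ∈ N₁ T T' ∪ Nbase κ i T T') : (crossings i (κ.off i) T' x).Nonempty := by
  obtain ⟨b, -, hb⟩ := (h.isBase_of_mem hx).exists_newEnd h hT'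
  exact ⟨b, hb.mem_crossings⟩

theorem exists_ownEnd_off_le (h : Edited T T' i (κ.off i) j) (hT' : EndsWithMarker d T')
    (hx : x ∈ N₁ T T' ∪ Nbase κ i T T') :
    ∃ b, OwnEnd κ i T T' x b ∧ κ.off i ≤ b + x.length := by
  obtain ⟨b, hbo, hb⟩ := (h.isBase_of_mem hx).exists_newEnd h hT'
  exact ⟨b, ⟨⟨hb.mem_crossings, hbo⟩, fun y hy b' hb' he =>
    hb.length_le y b' (h.isBase_of_mem hy).isInfix hb'.1.1 he⟩, hb.off_le⟩

theorem exists_ownEnd_assocS (h : Edited T T' i (κ.off i) j) (hT' : EndsWithMarker d T')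
    (hx : x ∈ N₁ T T' ∪ Nbase κ i T T') :
    ∃ b, OwnEnd κ i T T' x b ∧ assocS κ i T T' x = window T' i (b + x.length) := by
  have hxB := h.isBase_of_mem hx
  have hnil := ne_nil_of_mem_n hxB.mem_n
  have hxc := h.nonempty_crossings hT' hx
  have shared_iff : ∀ y ∈ N₁ T T' ∪ Nbase κ i T T', _ := fun y hy =>
    sLeft_eq_sLeft_or_sRight_iff (κ := κ) hnil (ne_nil_of_mem_n (h.isBase_of_mem hy).mem_n) hxc
      (h.nonempty_crossings hT' hy)
  unfold assocS
  split_ifs with hs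
  · -- The first crossing occurrence is a suffix of an occurrence of a longer substring of `T`, so
    -- it is preceded by the same character as the occurrences in `T`. The last one is not.
    obtain ⟨z, hz, hzl, hzs⟩ := hs
    obtain ⟨bz, hbz, hez⟩ := (shared_iff z hz).1 hzs
    obtain ⟨c, hc⟩ := exists_precededOnlyBy hxB.isInfix hxB.notMem_leftM
    have hFc := leftChar_of_shared_end hc (firstCrossing_mem hxc).1 hbz.1.1
      (h.isBase_of_mem hz).isInfix hez hzl
    obtain ⟨b, hb, -, hbc⟩ := h.exists_crossing_leftChar_ne hc hxB.mem_n.1.1.1 hnil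
    have hLc := (h.leftChar_first_or_last_ne hb hbc).resolve_left (not_not_intro hFc)
    refine ⟨_, ⟨⟨lastCrossing_mem hxc, Or.inr rfl⟩, fun y hy b' hb' he => ?_⟩,
      sRight_eq_window hnil⟩
    by_contra hlt
    exact hLc (leftChar_of_shared_end hc (lastCrossing_mem hxc).1 hb'.1.1
      (h.isBase_of_mem hy).isInfix he (by omega))
  · refine ⟨_, ⟨⟨firstCrossing_mem hxc, Or.inl rfl⟩, fun y hy b' hb' he => ?_⟩,
      sLeft_eq_window hnil⟩
    by_contra hlt
    exact hs ⟨y, hy, by omega, (shared_iff y hy).2 ⟨b', hb', he⟩⟩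

end Edited

/-! ### The weighted sum of the out-degrees -/

theorem notMem_nless_of_mem_nmid (hx : x ∈ Nmid κ i T T') : x ∉ Nless κ i T T' := by
  rintro ⟨-, v, hv, hle⟩
  obtain ⟨-, u, hu, he⟩ := hx
  rw [hu.eq_leftMax] at he
  rw [hv.eq_leftMax] at hle
  omega

open Classical in
/-- The out-degree of `x` in the CDAWG of `T'`, increased by the contributions of `x` to
`|Nmid| + 2 |Nless|`. -/
noncomputable def weight (κ : EditKind) (i : ℕ) (T T' x : List α) : ℕ :=
  rightDeg T' x + ((if x ∈ Nmid κ i T T' then 1 else 0) + 2 * if x ∈ Nless κ i T T' then 1 else 0)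

theorem weight_le_rightDeg_add_two : weight κ i T T' x ≤ rightDeg T' x + 2 := by
  unfold weight
  split_ifs with hmid hless
  · exact absurd hless (notMem_nless_of_mem_nmid hmid)
  all_goals omega

theorem weight_le (hx : x ∈ MaxSub T') {s : List α} (hs : s <:+ assocS κ i T T' x)
    (hd : rightDeg T' x ≤ rightDeg T s + 2) : weight κ i T T' x ≤ rightDeg T s + 2 := by
  have outDeg_le : ∀ u, IsU κ i T T' x u → outDeg T u ≤ rightDeg T s := fun u hu =>
    (outDeg_le_rightDeg T u).trans (rightDeg_le_of_suffix (hs.trans hu.2.1))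
  have he := outDeg_eq_rightDeg hx
  unfold weight
  split_ifs with hmid hless hless
  · exact absurd hless (notMem_nless_of_mem_nmid hmid)
  · obtain ⟨-, u, hu, e⟩ := hmid
    have := outDeg_le u hu
    omega
  · obtain ⟨-, u, hu, e⟩ := hless
    have := outDeg_le u hu
    omega
  · omega

namespace Edited

theorem exists_ownEnd_weight_le (h : Edited T T' i (κ.off i) j) (hT' : EndsWithMarker d T')
    (hx : x ∈ N₁ T T' ∪ Nbase κ i T T') : ∃ b, OwnEnd κ i T T' x b ∧ κ.off i ≤ b + x.length ∧
      (weight κ i T T' x ≤ rightDeg T (window T' (κ.off i) (b + x.length)) + 2 ∨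
        weight κ i T T' x ≤ rightDeg T (window T' (κ.off i) (b + x.length)) + 4 ∧
          ∃ b', OwnEnd κ i T T' x b' ∧ b' + x.length < κ.off i) := by
  have hN := (h.isBase_of_mem hx).mem_n
  have rightDeg_le : ∀ b ∈ crossings i (κ.off i) T' x,
      rightDeg T' x ≤ rightDeg T (window T' (κ.off i) (b + x.length)) + 2 := fun b hb =>
    (h.rightDeg_le_add_two hT' hN hb).trans
      (Nat.add_le_add_right (rightDeg_le_of_suffix (window_suffix_of_mem_crossings hb)) 2)
  obtain ⟨s, hs, hassoc⟩ := h.exists_ownEnd_assocS hT' hx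
  rcases le_or_gt (κ.off i) (s + x.length) with hoff | hoff
  · exact ⟨s, hs, hoff, Or.inl (weight_le hN.1.1
      (hassoc ▸ window_suffix_window h.le_off) (rightDeg_le s hs.isOuterCrossing.1))⟩
  · obtain ⟨t, ht, hofft⟩ := h.exists_ownEnd_off_le hT' hx
    have := rightDeg_le t ht.isOuterCrossing.1
    have := weight_le_rightDeg_add_two (κ := κ) (i := i) (T := T) (T' := T') (x := x)
    exact ⟨t, ht, hofft, Or.inr ⟨by omega, s, hs, hoff⟩⟩

theorem sum_weight_le (h : Edited T T' i (κ.off i) j) (hT' : EndsWithMarker d T')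
    {B : Finset (List α)} (hB : ∀ x ∈ B, x ∈ N₁ T T' ∪ Nbase κ i T T') :
    ∑ x ∈ B, weight κ i T T' x ≤ size T + 2 * B.card + 2 := by
  classical
  choose! s hs hoff hw using fun x hx => h.exists_ownEnd_weight_le hT' (hB x hx)
  let E := B.filter fun x => ∃ b, OwnEnd κ i T T' x b ∧ b + x.length < κ.off i
  -- An occurrence counted by `E` ends at `i`.
  have card_E : E.card ≤ 1 := by
    refine Finset.card_le_one.2 fun x hx y hy => ?_
    obtain ⟨hxB, b, hb, hlt⟩ := Finset.mem_filter.1 hx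
    obtain ⟨hyB, b', hb', hlt'⟩ := Finset.mem_filter.1 hy
    refine hb.eq_of_end_eq (hB x hxB) (hB y hyB) hb' ?_
    have := hb.isOuterCrossing.1.2.1
    have := hb'.isOuterCrossing.1.2.1
    have := h.off_le
    omega
  have sum_rightDeg : ∑ x ∈ B, rightDeg T (window T' (κ.off i) (s x + x.length)) ≤ size T :=
    sum_rightDeg_window_le_size
      (fun x hx y hy => (hs x hx).eq_of_end_eq (hB x hx) (hB y hy) (hs y hy)) hoff
      (fun x hx => (hs x hx).isOuterCrossing.1.1.add_length_le)
      fun x hx => (h.isBase_of_mem (hB x hx)).window_mem_rightM h hT'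
        (hs x hx).isOuterCrossing.1 (hoff x hx)
  have weight_le : ∀ x ∈ B, weight κ i T T' x ≤
      rightDeg T (window T' (κ.off i) (s x + x.length)) + 2 +
        if ∃ b, OwnEnd κ i T T' x b ∧ b + x.length < κ.off i then 2 else 0 := by
    intro x hx
    rcases hw x hx with hle | ⟨hle, hex⟩
    · omega
    · rwa [if_pos hex]
  have := Finset.sum_le_sum weight_le
  rw [Finset.sum_add_distrib, Finset.sum_add_distrib, Finset.sum_const, ← Finset.sum_filter,
    Finset.sum_const, smul_eq_mul, smul_eq_mul] at this
  change _ ≤ _ + E.card * 2 at this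
  omega

end Edited

end Basic

/-! ### Kept repeats and repeats that do not occur in `T` -/

section Transport

variable {T T' x z : List α} {b b' e i l p p' : ℕ}

theorem OccursAt.getElem?_eq_of_shift (h : OccursAt T x b) (h' : OccursAt T' x b') (hp : b ≤ p)
    (hpx : p < b + x.length) (he : p' + b = p + b') : T[p]? = T'[p']? := by
  rw [show p = b + (p - b) by omega, show p' = b' + (p - b) by omega, h.getElem? (by omega),
    h'.getElem? (by omega)]

theorem OccursAt.leftChar_eq_of_shift (h : OccursAt T x b) (h' : OccursAt T' x b') (hp : b < p)
    (hpx : p ≤ b + x.length) (he : p' + b = p + b') : leftChar T p = leftChar T' p' := by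
  rw [leftChar_of_pos (by omega), leftChar_of_pos (by omega)]
  exact h.getElem?_eq_of_shift h' (by omega) (by omega) (by omega)

theorem OccursAt.of_shift (hz : OccursAt T z p) (h : OccursAt T x b) (h' : OccursAt T' x b')
    (hp : b ≤ p) (hpx : p + z.length ≤ b + x.length) (he : p' + b = p + b') :
    OccursAt T' z p' := by
  have := h'.add_length_le
  refine occursAt_iff.2 ⟨by omega, fun k hk => ?_⟩
  rw [← hz.getElem? hk]
  exact (h.getElem?_eq_of_shift h' (by omega) (by omega) (by omega)).symm

theorem occursAt_window_of_overlap (h₁ : OccursAt T (window T' l i) p)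
    (h₂ : OccursAt T (window T' b e) p') (hlb : l ≤ b) (hbi : b ≤ i) (hie : i ≤ e)
    (he : e ≤ T'.length) (hp : p' + l = p + b) : OccursAt T (window T' l e) p := by
  have h₂' := h₂.add_length_le
  rw [length_window he] at h₂'
  rw [occursAt_iff, length_window he]
  refine ⟨by omega, fun k hk => ?_⟩
  rw [getElem?_window (by omega)]
  by_cases hk' : l + k < i
  · rw [h₁.getElem? (by rw [length_window (hie.trans he)]; omega), getElem?_window hk']
  · rw [show p + k = p' + (l + k - b) by omega, h₂.getElem? (by rw [length_window he]; omega),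
      getElem?_window (by omega), show b + (l + k - b) = l + k by omega]

end Transport

section LeftEnd

variable {T T' : List α} {i off j b p s : ℕ}

/-- The position of `T'` from which the extension of `window T' b i` to the left in `T` reaches to
the edited position `i`. -/
noncomputable def leftEnd (T T' : List α) (i b : ℕ) : ℕ := i - (leftMax T (window T' b i)).length

namespace Edited

theorem leftEnd_le (h : Edited T T' i off j) (hb : b ≤ i) : leftEnd T T' i b ≤ b := by
  have := (leftExt_leftMax (h.occursAt_window_left hb).isInfix).1.length_le
  rw [length_window h.le_length] at this
  unfold leftEnd
  omega

theorem window_leftEnd (h : Edited T T' i off j) (hb : b ≤ i) :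
    window T' (leftEnd T T' i b) i = leftMax T (window T' b i) := by
  obtain ⟨q, hq, ho⟩ := (leftExt_leftMax (h.occursAt_window_left hb).isInfix).2 b
    (h.occursAt_window_left hb)
  rw [length_window h.le_length] at hq
  obtain rfl : leftEnd T T' i b = q := by unfold leftEnd; omega
  have hle := (h.leftEnd_le hb).trans hb
  exact (h.occursAt_window_left hle).eq_of_length_eq ho (by rw [length_window h.le_length]; omega)

theorem window_leftEnd_mem_leftM (h : Edited T T' i off j) (hb : b ≤ i) :
    window T' (leftEnd T T' i b) i ∈ LeftM T :=
  h.window_leftEnd hb ▸ leftMax_mem_leftM (h.occursAt_window_left hb).isInfix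

theorem exists_occursAt_window_leftEnd (h : Edited T T' i off j) (hb : b ≤ i)
    (hp : OccursAt T (window T' b i) p) :
    ∃ q, q + b = p + leftEnd T T' i b ∧ OccursAt T (window T' (leftEnd T T' i b) i) q := by
  obtain ⟨q, hq, ho⟩ := (leftExt_leftMax (h.occursAt_window_left hb).isInfix).2 p hp
  rw [← h.window_leftEnd hb] at hq ho
  have := h.leftEnd_le hb
  rw [length_window h.le_length, length_window h.le_length] at hq
  exact ⟨q, by omega, ho⟩

-- Every occurrence of the window in `T` extends to the left end, so an occurrence at `s` would
-- provide one further left in `T`, without end.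
theorem not_occursAt_of_leftEnd_le (h : Edited T T' i off j) (hb : b ≤ i)
    (hs : leftEnd T T' i b ≤ s) (hsb : s < b) : ¬ OccursAt T' (window T' b i) s := by
  intro ho
  have descent : ∀ p, ¬ OccursAt T (window T' b i) p := by
    intro p
    induction p using Nat.strong_induction_on with
    | _ p ih =>
      intro hp
      obtain ⟨q, hq, hoq⟩ := h.exists_occursAt_window_leftEnd hb hp
      refine ih (p - (b - s)) (by omega) (ho.of_shift
        (occursAt_window (by omega) h.le_length) hoq hs ?_ (by omega))
      rw [length_window h.le_length, length_window h.le_length]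
      omega
  exact descent _ (h.occursAt_window_left hb)

end Edited

end LeftEnd

section Pairs

variable {T x y : List α} {b₁ b₂ p₁ p₂ m : ℕ}

theorem leftChar_eq_of_pairs_of_lt (hb₁ : OccursAt T x b₁) (hb₂ : OccursAt T x b₂)
    (hp₁ : OccursAt T y p₁) (hp₂ : OccursAt T y p₂) (hb : b₁ < b₂) (hpb : p₂ < b₂)
    (hby : b₂ ≤ p₁ + y.length + 1) (hm : m + p₂ = p₁ + b₂) (hmb : m < b₁)
    (hend : p₁ + y.length < m + x.length) : leftChar T b₁ = leftChar T b₂ := by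
  have hlen := hp₁.add_length_le
  have hw := length_window (b := m) hlen
  have hw_m := occursAt_window (b := m) (by omega) hlen
  have hw_b₂ := hw_m.of_shift hp₁ hp₂ (by omega) (by omega) (p' := b₂) (by omega)
  have hw_b₁ := hw_b₂.of_shift hb₂ hb₁ le_rfl (by omega) (p' := b₁) (by omega)
  exact leftChar_eq_of_three hw_m hw_b₁ hw_b₂ hmb hb (by omega)

theorem leftChar_eq_of_pairs_of_gt (hb₁ : OccursAt T x b₁) (hb₂ : OccursAt T x b₂)
    (hp₁ : OccursAt T y p₁) (hp₂ : OccursAt T y p₂) (hp : p₁ < p₂) (hpb₁ : p₁ < b₁)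
    (hbx : b₂ ≤ b₁ + x.length + 1) (hby : b₂ ≤ p₁ + y.length + 1) (hm : m + p₂ = p₁ + b₂)
    (hmb : b₁ < m) : leftChar T b₁ = leftChar T b₂ := by
  have hlen : min (b₁ + x.length) (p₁ + y.length) ≤ T.length :=
    (min_le_left _ _).trans hb₁.add_length_le
  have hw := length_window (b := b₁) hlen
  have hw_b₁ := occursAt_window (b := b₁) (by omega) hlen
  obtain ⟨q, hq⟩ : ∃ q, q + p₁ = b₁ + p₂ := ⟨b₁ - p₁ + p₂, by omega⟩
  have hw_q := hw_b₁.of_shift hp₁ hp₂ hpb₁.le (by omega) hq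
  have hw_b₂ := hw_b₁.of_shift hb₁ hb₂ le_rfl (by omega) (p' := b₂) (by omega)
  rw [hp₁.leftChar_eq_of_shift hp₂ hpb₁ (by omega) hq]
  exact leftChar_eq_of_three hw_b₁ hw_q hw_b₂ (by omega) (by omega) (by omega)

-- The position `m` corresponds to `b₂` when the second occurrence of `y` is moved to the first one.
-- A part of `x` or of its left end in the moved occurrence then occurs three times.
theorem leftChar_eq_of_pairs (hb₁ : OccursAt T x b₁) (hb₂ : OccursAt T x b₂)
    (hp₁ : OccursAt T y p₁) (hp₂ : OccursAt T y p₂) (hb : b₁ < b₂) (hp : p₁ < p₂)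
    (hpb₁ : p₁ < b₁) (hpb₂ : p₂ < b₂) (hbx : b₂ ≤ b₁ + x.length + 1)
    (hby : b₂ ≤ p₁ + y.length + 1) (hm : m + p₂ = p₁ + b₂)
    (hend : m < b₁ → p₁ + y.length < m + x.length) : leftChar T b₁ = leftChar T b₂ := by
  rcases lt_trichotomy m b₁ with hlt | rfl | hgt
  · exact leftChar_eq_of_pairs_of_lt hb₁ hb₂ hp₁ hp₂ hb hpb₂ hby hm hlt (hend hlt)
  · exact (hp₂.leftChar_eq_of_shift hp₁ hpb₂ (by omega) (by omega)).symm
  · exact leftChar_eq_of_pairs_of_gt hb₁ hb₂ hp₁ hp₂ hp hpb₁ hbx hby hm hgt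

end Pairs

section Kept

variable {d : α} {T T' x y : List α} {i off j : ℕ}

namespace IsAdd

theorem leftChar_first_ne_last (hx : IsAdd T T' i off x) (h : Edited T T' i off j)
    (hT' : EndsWithMarker d T') (hxT : ¬ x <:+: T) :
    leftChar T' (firstCrossing i off T' x) ≠ leftChar T' (lastCrossing i off T' x) := by
  intro he
  have hlt := hx.first_lt_last h hT'
  obtain ⟨c, hc⟩ := (hx.last_mem hT').1.exists_leftChar (by omega)
  obtain ⟨b, hb, hbc⟩ := exists_leftChar_ne hx.mem_n.1.1.1 c
  have hs := h.straddles hb hxT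
  have := h.leftChar_first_or_last_ne ⟨hb, hs.2.le, hs.1.le⟩ hbc
  rw [he, or_self] at this
  exact this hc

theorem occursAt_first_of_last_eq (hx : IsAdd T T' i off x) (hy : IsAdd T T' i off y)
    (hT' : EndsWithMarker d T') (he : lastCrossing i off T' x = lastCrossing i off T' y)
    (hlt : x.length < y.length) : OccursAt T' x (firstCrossing i off T' y) :=
  (hx.last_mem hT').1.of_shift (hy.last_mem hT').1 (hy.first_mem hT').1 (by omega) (by omega)
    (by omega)

theorem first_notMem_crossings_of_last_eq (hx : IsAdd T T' i off x) (hy : IsAdd T T' i off y)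
    (h : Edited T T' i off j) (hT' : EndsWithMarker d T')
    (he : lastCrossing i off T' x = lastCrossing i off T' y) (hlt : x.length < y.length) :
    firstCrossing i off T' y ∉ crossings i off T' x := by
  intro hc
  have := hy.first_lt_last h hT'
  refine hx.rightChar_first_ne_last h hT' ?_
  rw [← h.rightChar_eq_first hc (by omega)]
  exact ((hy.last_mem hT').1.getElem?_eq_of_shift (hy.first_mem hT').1 (by omega) (by omega)
    (by omega)).symm

theorem first_add_length_lt_of_last_eq (hx : IsAdd T T' i off x) (hy : IsAdd T T' i off y)
    (h : Edited T T' i off j) (hT' : EndsWithMarker d T')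
    (he : lastCrossing i off T' x = lastCrossing i off T' y) (hlt : x.length < y.length) :
    firstCrossing i off T' y + x.length < i := by
  by_contra hn
  exact hx.first_notMem_crossings_of_last_eq hy h hT' he hlt
    ⟨hx.occursAt_first_of_last_eq hy hT' he hlt, by omega, (hy.first_mem hT').2.2⟩

theorem length_le_of_last_eq (hx : IsAdd T T' i off x) (hy : IsAdd T T' i off y)
    (h : Edited T T' i off j) (hT' : EndsWithMarker d T') (hxT : ¬ x <:+: T)
    (he : lastCrossing i off T' x = lastCrossing i off T' y) : y.length ≤ x.length := by
  by_contra hlt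
  have := h.straddles (hx.occursAt_first_of_last_eq hy hT' he (by omega)) hxT
  have := hx.first_add_length_lt_of_last_eq hy h hT' he (by omega)
  omega

end IsAdd

namespace IsKept

theorem exists_leftChar (hx : IsKept T T' i off x) (h : Edited T T' i off j) :
    ∃ c, PrecededOnlyBy T x c ∧ leftChar T' (firstCrossing i off T' x) = some c ∧
      leftChar T' (lastCrossing i off T' x) ≠ some c := by
  obtain ⟨c, hc⟩ := exists_precededOnlyBy hx.isInfix hx.isAdd.notMem_leftM
  obtain ⟨b, hb, -, hbc⟩ := h.exists_crossing_leftChar_ne hc hx.isAdd.mem_n.1.1.1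
    (ne_nil_of_mem_n hx.isAdd.mem_n)
  have hF := hx.leftChar_first c hc
  exact ⟨c, hc, hF, (h.leftChar_first_or_last_ne hb hbc).resolve_left (not_not.2 hF)⟩

theorem leftChar_first_ne_last (hx : IsKept T T' i off x) (h : Edited T T' i off j) :
    leftChar T' (firstCrossing i off T' x) ≠ leftChar T' (lastCrossing i off T' x) := by
  obtain ⟨c, -, hF, hL⟩ := hx.exists_leftChar h
  rw [hF]
  exact hL.symm

theorem not_isInfix_window_first (hx : IsKept T T' i off x) (h : Edited T T' i off j)
    (hT' : EndsWithMarker d T') :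
    ¬ window T' (firstCrossing i off T' x) (firstCrossing i off T' x + x.length + 1) <:+: T := by
  obtain ⟨a, ha⟩ := exists_followedOnlyBy hx.isInfix hx.isAdd.notMem_rightM
  obtain ⟨aF, haF⟩ := exists_rightChar_of_mem_n hT' hx.isAdd.mem_n (hx.isAdd.first_mem hT').1
  have hne : aF ≠ a := fun e => hx.isAdd.rightChar_first_ne_last h hT' (by
    rw [haF, hx.rightChar_last a ha, e])
  have hw := (occursAt_append_singleton.2 ⟨(hx.isAdd.first_mem hT').1, haF⟩).eq_window
  rw [List.length_append, List.length_singleton, ← add_assoc] at hw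
  exact hw ▸ ha.not_isInfix hne

theorem isInfix_window_leftEnd (hx : IsKept T T' i off x) (h : Edited T T' i off j)
    (hT' : EndsWithMarker d T') :
    window T' (leftEnd T T' i (firstCrossing i off T' x)) (firstCrossing i off T' x + x.length)
      <:+: T := by
  have hF := hx.isAdd.first_mem hT'
  have hFi := hx.isAdd.first_le h hT'
  obtain ⟨p, hp⟩ := isInfix_iff_exists_occursAt.1 hx.isInfix
  obtain ⟨q, hq, ho⟩ :=
    h.exists_occursAt_window_leftEnd hFi (hp.of_prefix (window_prefix_of_mem_crossings hF))
  exact (occursAt_window_of_overlap ho (hF.1.eq_window ▸ hp) (h.leftEnd_le hFi) hFi hF.2.1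
    hF.1.add_length_le (by omega)).isInfix

theorem end_le_of_leftEnd_eq (hx : IsKept T T' i off x) (hy : IsKept T T' i off y)
    (h : Edited T T' i off j) (hT' : EndsWithMarker d T')
    (he : leftEnd T T' i (firstCrossing i off T' x) = leftEnd T T' i (firstCrossing i off T' y)) :
    firstCrossing i off T' x + x.length ≤ firstCrossing i off T' y + y.length := by
  by_contra hlt
  refine hy.not_isInfix_window_first h hT' (List.IsInfix.trans ?_ (hx.isInfix_window_leftEnd h hT'))
  rw [he]
  exact (window_suffix_window (h.leftEnd_le (hy.isAdd.first_le h hT'))).isInfix.trans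
    (window_prefix_window (by omega)).isInfix

theorem end_eq_of_leftEnd_eq (hx : IsKept T T' i off x) (hy : IsKept T T' i off y)
    (h : Edited T T' i off j) (hT' : EndsWithMarker d T')
    (he : leftEnd T T' i (firstCrossing i off T' x) = leftEnd T T' i (firstCrossing i off T' y)) :
    firstCrossing i off T' x + x.length = firstCrossing i off T' y + y.length :=
  (hx.end_le_of_leftEnd_eq hy h hT' he).antisymm (hy.end_le_of_leftEnd_eq hx h hT' he.symm)

theorem leftChar_eq_first_of_lt (hx : IsKept T T' i off x) (h : Edited T T' i off j)
    (hT' : EndsWithMarker d T') {m : ℕ} (hm : OccursAt T' x m)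
    (hlt : m < firstCrossing i off T' x) :
    leftChar T' m = leftChar T' (firstCrossing i off T' x) := by
  obtain ⟨c, hc, hF, -⟩ := hx.exists_leftChar h
  have hFx := (hx.isAdd.first_mem hT').2.2
  have hFi := hx.isAdd.first_le h hT'
  have hmi : m + x.length ≤ i := by
    by_contra hn
    exact hlt.not_ge (firstCrossing_le ⟨hm, by omega, by omega⟩)
  rw [hF, ← hc m (h.occursAt_left hm hmi), h.leftChar_left (by omega)]

theorem last_le_last (hx : IsKept T T' i off x) (hy : IsAdd T T' i off y)
    (h : Edited T T' i off j) (hT' : EndsWithMarker d T')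
    (hF : firstCrossing i off T' y < firstCrossing i off T' x) :
    lastCrossing i off T' x ≤ lastCrossing i off T' y := by
  by_contra hL
  have hFx := hx.isAdd.first_mem hT'
  have hLx := hx.isAdd.last_mem hT'
  have hFy := hy.first_mem hT'
  have hLy := hy.last_mem hT'
  have hyL := hy.first_lt_last h hT'
  have hoff := h.off_le
  have := hFx.2
  have := hLx.2
  have := hFy.2
  obtain ⟨m, hm⟩ : ∃ m, m + lastCrossing i off T' y =
      firstCrossing i off T' y + lastCrossing i off T' x :=
    ⟨firstCrossing i off T' y + lastCrossing i off T' x - lastCrossing i off T' y, by omega⟩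
  refine hx.leftChar_first_ne_last h (leftChar_eq_of_pairs hFx.1 hLx.1 hFy.1 hLy.1
    (hx.isAdd.first_lt_last h hT') hyL hF (by omega) (by omega) (by omega) hm fun hlt => ?_)
  by_contra hend
  have hxm := hLx.1.of_shift hLy.1 hFy.1 (by omega) (by omega) (p' := m) (by omega)
  refine hx.leftChar_first_ne_last h ?_
  rw [← hx.leftChar_eq_first_of_lt h hT' hxm hlt]
  exact (hLy.1.leftChar_eq_of_shift hFy.1 (by omega) (by omega) (by omega)).symm

theorem first_lt_last (hx : IsKept T T' i off x) (hy : IsAdd T T' i off y)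
    (h : Edited T T' i off j) (hT' : EndsWithMarker d T') :
    firstCrossing i off T' x < lastCrossing i off T' y := by
  by_contra hle
  have := hy.first_lt_last h hT'
  have := hx.isAdd.first_lt_last h hT'
  have := hx.last_le_last hy h hT' (by omega)
  omega

end IsKept

end Kept

section Charging

variable {d : α} {T T' s x y z : List α} {i off j : ℕ}

/-- `s` has at most one occurrence in `T`. -/
def OccursOnce (T s : List α) : Prop := ∀ b b', OccursAt T s b → OccursAt T s b' → b = b'

theorem not_occursOnce_nil (hT : T ≠ []) : ¬ OccursOnce T [] := fun ho =>
  hT (List.eq_nil_of_length_eq_zero (ho _ _ ⟨T, [], rfl, by simp⟩ ⟨[], T, rfl, by simp⟩))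

namespace IsKept

theorem length_le_of_occursOnce (hx : IsKept T T' i off x) (hy : IsAdd T T' i off y)
    (h : Edited T T' i off j) (hT' : EndsWithMarker d T')
    (ho : OccursOnce T (window T' (firstCrossing i off T' x) i))
    (he : lastCrossing i off T' x = lastCrossing i off T' y) : y.length ≤ x.length := by
  by_contra hlt
  have hF := hx.isAdd.first_mem hT'
  have hxy := hx.isAdd.occursAt_first_of_last_eq hy hT' he (by omega)
  have hend := hx.isAdd.first_add_length_lt_of_last_eq hy h hT' he (by omega)
  have := ho _ _ ((h.occursAt_left hxy hend.le).of_prefix (window_prefix_of_mem_crossings hF))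
    (h.occursAt_window_left (hx.isAdd.first_le h hT'))
  have := hF.2.1
  omega

theorem last_le_of_occursOnce (hx : IsKept T T' i off x) (h : Edited T T' i off j)
    (hT' : EndsWithMarker d T') (ho : OccursOnce T (window T' (firstCrossing i off T' x) i)) :
    lastCrossing i off T' x ≤ i := by
  by_contra hgt
  have hF := hx.isAdd.first_mem hT'
  have hL := hx.isAdd.last_mem hT'
  have := h.le_resume
  have := h.off_le
  have := hx.isAdd.first_lt_last h hT'
  have := hL.2.2
  have := ho _ _ ((h.occursAt_right hL.1 (by omega)).of_prefix (window_prefix_of_mem_crossings hF))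
    (h.occursAt_window_left (hx.isAdd.first_le h hT'))
  have hw := length_window (b := firstCrossing i off T' x) h.le_length
  have hnil : window T' (firstCrossing i off T' x) i = [] :=
    List.eq_nil_of_length_eq_zero (by omega)
  rw [hnil] at ho
  exact not_occursOnce_nil (fun e => ne_nil_of_mem_n hx.isAdd.mem_n
    (List.eq_nil_of_infix_nil (e ▸ hx.isInfix))) ho

end IsKept

/-- Two kept repeats with the same left end, of which `x` is the shorter one. -/
structure Conflict (T T' : List α) (i off : ℕ) (x y : List α) : Prop where
  left : IsKept T T' i off x
  right : IsKept T T' i off y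
  leftEnd_eq : leftEnd T T' i (firstCrossing i off T' x) = leftEnd T T' i (firstCrossing i off T' y)
  length_lt : x.length < y.length

namespace Conflict

theorem first_lt_first (hc : Conflict T T' i off x y) (h : Edited T T' i off j)
    (hT' : EndsWithMarker d T') : firstCrossing i off T' y < firstCrossing i off T' x := by
  have := hc.left.end_eq_of_leftEnd_eq hc.right h hT' hc.leftEnd_eq
  have := hc.length_lt
  omega

theorem not_occursAt_of_le (hc : Conflict T T' i off x y) (h : Edited T T' i off j)
    (hT' : EndsWithMarker d T') {b : ℕ} (hb : firstCrossing i off T' y ≤ b)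
    (hbx : b < firstCrossing i off T' x) : ¬ OccursAt T' x b := fun ho => by
  refine h.not_occursAt_of_leftEnd_le (hc.left.isAdd.first_le h hT') ?_ hbx
    (ho.of_prefix (window_prefix_of_mem_crossings (hc.left.isAdd.first_mem hT')))
  rw [hc.leftEnd_eq]
  exact (h.leftEnd_le (hc.right.isAdd.first_le h hT')).trans hb

theorem last_lt_last (hc : Conflict T T' i off x y) (h : Edited T T' i off j)
    (hT' : EndsWithMarker d T') : lastCrossing i off T' x < lastCrossing i off T' y := by
  have hF := hc.first_lt_first h hT'
  refine (hc.left.last_le_last hc.right.isAdd h hT' hF).lt_of_ne fun he => ?_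
  exact hc.not_occursAt_of_le h hT' le_rfl hF
    (hc.left.isAdd.occursAt_first_of_last_eq hc.right.isAdd hT' he hc.length_lt)

theorem length_le_of_last_eq (hc : Conflict T T' i off x y) (hz : IsAdd T T' i off z)
    (h : Edited T T' i off j) (hT' : EndsWithMarker d T')
    (he : lastCrossing i off T' x = lastCrossing i off T' z) : z.length ≤ x.length := by
  by_contra hlt
  have hend := hc.left.isAdd.first_add_length_lt_of_last_eq hz h hT' he (by omega)
  have := (hc.left.isAdd.first_mem hT').2.1
  have hF : firstCrossing i off T' z < firstCrossing i off T' y := by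
    by_contra hn
    exact hc.not_occursAt_of_le h hT' (by omega) (by omega)
      (hc.left.isAdd.occursAt_first_of_last_eq hz hT' he (by omega))
  have := hc.right.last_le_last hz h hT' hF
  have := hc.last_lt_last h hT'
  omega

end Conflict

/-- The additional repeats that are not among those that occur in `T` without being kept. -/
structure IsRest (T T' : List α) (i off : ℕ) (x : List α) : Prop where
  isAdd : IsAdd T T' i off x
  isKept : x <:+: T → IsKept T T' i off x

/-- The remaining repeats that are charged to their last crossing occurrence. The other ones are
charged to the left end of the first one, which for repeats that satisfy `IsLate` would either occur
only once in `T` or be the left end of a longer repeat, too. -/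
def IsLate (T T' : List α) (i off : ℕ) (x : List α) : Prop :=
  x <:+: T → OccursOnce T (window T' (firstCrossing i off T' x) i) ∨ ∃ y, Conflict T T' i off x y

open Classical in
/-- The position such that the substring of `T'` from there to the edited position `i` is charged
for `x`. -/
noncomputable def chargePos (T T' : List α) (i off : ℕ) (x : List α) : ℕ :=
  if IsLate T T' i off x then lastCrossing i off T' x
  else leftEnd T T' i (firstCrossing i off T' x)

theorem chargePos_of_isLate (hx : IsLate T T' i off x) :
    chargePos T T' i off x = lastCrossing i off T' x := if_pos hx

theorem chargePos_of_not_isLate (hx : ¬ IsLate T T' i off x) :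
    chargePos T T' i off x = leftEnd T T' i (firstCrossing i off T' x) := if_neg hx

theorem isInfix_of_not_isLate (hx : ¬ IsLate T T' i off x) : x <:+: T :=
  by_contra fun hxT => hx fun hxT' => absurd hxT' hxT

namespace IsLate

theorem last_le (hl : IsLate T T' i off x) (hx : IsRest T T' i off x) (h : Edited T T' i off j)
    (hT' : EndsWithMarker d T') : lastCrossing i off T' x ≤ i := by
  have hoff := h.off_le
  by_cases hxT : x <:+: T
  · rcases hl hxT with ho | ⟨y, hc⟩
    · exact (hx.isKept hxT).last_le_of_occursOnce h hT' ho
    · have := hc.last_lt_last h hT'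
      have := (hc.right.isAdd.last_mem hT').2.2
      omega
  · have := (h.straddles (hx.isAdd.last_mem hT').1 hxT).1
    omega

theorem window_mem_leftM (hl : IsLate T T' i off x) (hx : IsRest T T' i off x)
    (h : Edited T T' i off j) (hT' : EndsWithMarker d T') :
    window T' (lastCrossing i off T' x) i ∈ LeftM T := by
  refine hx.isAdd.window_last_mem_leftM h hT' (hl.last_le hx h hT') ?_
  by_cases hxT : x <:+: T
  · exact (hx.isKept hxT).leftChar_first_ne_last h
  · exact hx.isAdd.leftChar_first_ne_last h hT' hxT

theorem length_le_of_last_eq (hl : IsLate T T' i off x) (hx : IsRest T T' i off x)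
    (hy : IsAdd T T' i off y) (h : Edited T T' i off j) (hT' : EndsWithMarker d T')
    (he : lastCrossing i off T' x = lastCrossing i off T' y) : y.length ≤ x.length := by
  by_cases hxT : x <:+: T
  · rcases hl hxT with ho | ⟨z, hc⟩
    · exact (hx.isKept hxT).length_le_of_occursOnce hy h hT' ho he
    · exact hc.length_le_of_last_eq hy h hT' he
  · exact hx.isAdd.length_le_of_last_eq hy h hT' hxT he

theorem eq_of_last_eq (hlx : IsLate T T' i off x) (hly : IsLate T T' i off y)
    (hx : IsRest T T' i off x) (hy : IsRest T T' i off y) (h : Edited T T' i off j)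
    (hT' : EndsWithMarker d T') (he : lastCrossing i off T' x = lastCrossing i off T' y) :
    x = y :=
  (he ▸ (hx.isAdd.last_mem hT').1 : OccursAt T' x _).eq_of_length_eq (hy.isAdd.last_mem hT').1
    ((hly.length_le_of_last_eq hy hx.isAdd h hT' he.symm).antisymm
      (hlx.length_le_of_last_eq hx hy.isAdd h hT' he))

end IsLate

namespace IsRest

theorem eq_of_leftEnd_eq (hx : IsRest T T' i off x) (hy : IsRest T T' i off y)
    (hlx : ¬ IsLate T T' i off x) (hly : ¬ IsLate T T' i off y) (h : Edited T T' i off j)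
    (hT' : EndsWithMarker d T')
    (he : leftEnd T T' i (firstCrossing i off T' x) = leftEnd T T' i (firstCrossing i off T' y)) :
    x = y := by
  have hkx := hx.isKept (isInfix_of_not_isLate hlx)
  have hky := hy.isKept (isInfix_of_not_isLate hly)
  have hend := hkx.end_eq_of_leftEnd_eq hky h hT' he
  have hlen : x.length = y.length := by
    rcases lt_trichotomy x.length y.length with hlt | heq | hgt
    · exact absurd (fun _ => Or.inr ⟨y, hkx, hky, he, hlt⟩) hlx
    · exact heq
    · exact absurd (fun _ => Or.inr ⟨x, hky, hkx, he.symm, hgt⟩) hly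
  have hox := (hx.isAdd.first_mem hT').1
  rw [show firstCrossing i off T' x = firstCrossing i off T' y by omega] at hox
  exact hox.eq_of_length_eq (hy.isAdd.first_mem hT').1 hlen

theorem leftEnd_lt_last (hx : IsRest T T' i off x) (hlx : ¬ IsLate T T' i off x)
    (hy : IsAdd T T' i off y) (h : Edited T T' i off j) (hT' : EndsWithMarker d T') :
    leftEnd T T' i (firstCrossing i off T' x) < lastCrossing i off T' y :=
  (h.leftEnd_le (hx.isAdd.first_le h hT')).trans_lt
    ((hx.isKept (isInfix_of_not_isLate hlx)).first_lt_last hy h hT')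

theorem eq_of_chargePos_eq (hx : IsRest T T' i off x) (hy : IsRest T T' i off y)
    (h : Edited T T' i off j) (hT' : EndsWithMarker d T')
    (he : chargePos T T' i off x = chargePos T T' i off y) : x = y := by
  by_cases hlx : IsLate T T' i off x <;> by_cases hly : IsLate T T' i off y <;>
    simp only [chargePos_of_isLate, chargePos_of_not_isLate, hlx, hly, not_false_eq_true] at he
  · exact hlx.eq_of_last_eq hly hx hy h hT' he
  · exact absurd he (hy.leftEnd_lt_last hly hx.isAdd h hT').ne'
  · exact absurd he (hx.leftEnd_lt_last hlx hy.isAdd h hT').ne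
  · exact hx.eq_of_leftEnd_eq hy hlx hly h hT' he

theorem chargePos_le (hx : IsRest T T' i off x) (h : Edited T T' i off j)
    (hT' : EndsWithMarker d T') : chargePos T T' i off x ≤ i := by
  by_cases hl : IsLate T T' i off x
  · exact chargePos_of_isLate hl ▸ hl.last_le hx h hT'
  · rw [chargePos_of_not_isLate hl]
    exact (h.leftEnd_le (hx.isAdd.first_le h hT')).trans (hx.isAdd.first_le h hT')

theorem window_chargePos_mem_leftM (hx : IsRest T T' i off x) (h : Edited T T' i off j)
    (hT' : EndsWithMarker d T') : window T' (chargePos T T' i off x) i ∈ LeftM T := by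
  by_cases hl : IsLate T T' i off x
  · exact chargePos_of_isLate hl ▸ hl.window_mem_leftM hx h hT'
  · exact chargePos_of_not_isLate hl ▸ h.window_leftEnd_mem_leftM (hx.isAdd.first_le h hT')

theorem not_occursOnce_window_chargePos (hx : IsRest T T' i off x) (h : Edited T T' i off j)
    (hT' : EndsWithMarker d T') : ¬ OccursOnce T (window T' (chargePos T T' i off x) i) := by
  intro ho
  by_cases hl : IsLate T T' i off x
  · rw [chargePos_of_isLate hl] at ho
    exact (hx.isAdd.first_lt_last h hT').ne (ho _ _ (hx.isAdd.occursAt_window_last_first h hT')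
      (h.occursAt_window_left (hl.last_le hx h hT')))
  · rw [chargePos_of_not_isLate hl] at ho
    refine hl fun _ => Or.inl fun b b' hb hb' => ?_
    have hF := hx.isAdd.first_le h hT'
    obtain ⟨q, hq, hoq⟩ := h.exists_occursAt_window_leftEnd hF hb
    obtain ⟨q', hq', hoq'⟩ := h.exists_occursAt_window_leftEnd hF hb'
    have := ho _ _ hoq hoq'
    omega

end IsRest

theorem Edited.card_rest_le (h : Edited T T' i off j) (hT' : EndsWithMarker d T')
    {K : Finset (List α)} (hK : ∀ x ∈ K, IsRest T T' i off x) : K.card ≤ (MR T).ncard := by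
  refine card_le_ncard_mr_of_starts
    (fun x hx y hy he => (hK x hx).eq_of_chargePos_eq (hK y hy) h hT' he)
    (fun x hx => (hK x hx).chargePos_le h hT') h.le_length
    (fun x hx => (hK x hx).window_chargePos_mem_leftM h hT') fun x hx => ?_
  have := (hK x hx).not_occursOnce_window_chargePos h hT'
  simp only [OccursOnce, not_forall] at this
  obtain ⟨b, b', hb, hb', hne⟩ := this
  exact ⟨b, b', hne, hb, hb'⟩

end Charging

/-! ### The size of the edited graph -/

section Size

variable {d : α} {κ : EditKind} {T T' : List α} {i off j : ℕ}

theorem size_le_sum_rightDeg {C : Finset (List α)} (hC : MR T ⊆ C) :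
    size T ≤ ∑ x ∈ C, rightDeg T x := by
  classical
  have maxSub_subset : (finite_maxSub T).toFinset ⊆ insert T C := fun x hx => by
    rw [Set.Finite.mem_toFinset] at hx
    rw [Finset.mem_insert]
    exact or_iff_not_imp_left.2 fun hne => hC ⟨hx, hne⟩
  rw [size_eq_sum_rightDeg]
  exact (Finset.sum_le_sum_of_subset maxSub_subset).trans_eq
    (Finset.sum_insert_of_eq_zero_if_notMem fun _ => rightDeg_self T)

theorem sum_union_le {ι : Type*} [DecidableEq ι] (s t : Finset ι) (f : ι → ℕ) :
    ∑ x ∈ s ∪ t, f x ≤ ∑ x ∈ s, f x + ∑ x ∈ t, f x :=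
  (Nat.le_add_right _ _).trans_eq Finset.sum_union_inter

theorem mr_subset_union (κ : EditKind) (i : ℕ) (T T' : List α) :
    MR T' ⊆ MaxSub T ∪ N₂ T T' ∪ (N₁ T T' ∪ Nbase κ i T T') ∪ Nadd κ i T T' := by
  rintro x ⟨hx, hne⟩
  by_cases hold : x ∈ MaxSub T
  · exact Or.inl (Or.inl (Or.inl hold))
  have hN : x ∈ N T T' := ⟨⟨hx, hold⟩, hne⟩
  by_cases hL : x ∈ LeftM T
  · exact Or.inl (Or.inl (Or.inr ⟨hN, hL⟩))
  by_cases hR : x ∈ RightM T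
  · exact Or.inl (Or.inr (Or.inl ⟨hN, hR⟩))
  by_cases hadd : x ∈ Nadd κ i T T'
  · exact Or.inr hadd
  · exact Or.inl (Or.inr (Or.inr ⟨mem_n₃_iff.2 ⟨hN, hL, hR⟩, hadd⟩))

theorem finite_n (T T' : List α) : (N T T').Finite :=
  (finite_maxSub T').subset fun _ hx => hx.1.1

theorem exists_finset_of_subset_n {C : Set (List α)} (hC : C ⊆ N T T') :
    ∃ F : Finset (List α), (F : Set (List α)) = C :=
  ((finite_n T T').subset hC).exists_finset_coe

theorem sum_weight {B : Finset (List α)} (hB : (B : Set (List α)) = N₁ T T' ∪ Nbase κ i T T') :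
    ∑ x ∈ B, weight κ i T T' x =
      ∑ x ∈ B, rightDeg T' x + ((Nmid κ i T T').ncard + 2 * (Nless κ i T T').ncard) := by
  classical
  have sum_indicator (C : Set (List α)) (hC : C ⊆ B) :
      ∑ x ∈ B, (if x ∈ C then 1 else 0) = C.ncard := by
    rw [Finset.sum_boole, Nat.cast_id, ← Set.ncard_coe_finset, Finset.coe_filter]
    congr 1
    exact Set.inter_eq_right.2 hC
  unfold weight
  rw [Finset.sum_add_distrib, Finset.sum_add_distrib, ← Finset.mul_sum,
    ← sum_indicator (Nmid κ i T T') (hB ▸ fun _ hx => hx.1),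
    ← sum_indicator (Nless κ i T T') (hB ▸ fun _ hx => hx.1)]

theorem size_le_sum_classes {S A B D : Finset (List α)} (hS : (S : Set (List α)) = MaxSub T)
    (hA : (A : Set (List α)) = N₂ T T') (hB : (B : Set (List α)) = N₁ T T' ∪ Nbase κ i T T')
    (hD : (D : Set (List α)) = Nadd κ i T T') :
    size T' ≤ ∑ x ∈ S, rightDeg T' x + ∑ x ∈ A, rightDeg T' x + ∑ x ∈ B, rightDeg T' x +
      ∑ x ∈ D, rightDeg T' x := by
  classical
  have hsub : MR T' ⊆ ((S ∪ A ∪ B ∪ D : Finset (List α)) : Set (List α)) := by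
    simp only [Finset.coe_union, hS, hA, hB, hD]
    exact mr_subset_union κ i T T'
  refine (size_le_sum_rightDeg hsub).trans ((sum_union_le _ _ _).trans ?_)
  gcongr
  refine (sum_union_le _ _ _).trans ?_
  gcongr
  exact sum_union_le _ _ _

theorem exists_coe_union_eq_nadd [DecidableEq α] (κ : EditKind) (i : ℕ) (T T' : List α) :
    ∃ Q K : Finset (List α),
      (∀ x ∈ Q, IsAdd T T' i (κ.off i) x ∧ x <:+: T ∧ ¬ IsKept T T' i (κ.off i) x) ∧
      (∀ x ∈ K, IsRest T T' i (κ.off i) x) ∧ ((Q ∪ K : Finset (List α)) : Set (List α)) =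
        Nadd κ i T T' := by
  classical
  obtain ⟨D, hD⟩ := exists_finset_of_subset_n (C := Nadd κ i T T') fun _ hx => hx.1.1
  have isAdd {x} (hx : x ∈ D) : IsAdd T T' i (κ.off i) x := mem_nadd_iff.1 (hD ▸ hx)
  refine ⟨D.filter fun x => x <:+: T ∧ ¬ IsKept T T' i (κ.off i) x,
    D.filter fun x => ¬ (x <:+: T ∧ ¬ IsKept T T' i (κ.off i) x),
    fun x hx => ?_, fun x hx => ?_, ?_⟩
  · exact ⟨isAdd (Finset.mem_filter.1 hx).1, (Finset.mem_filter.1 hx).2⟩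
  · exact ⟨isAdd (Finset.mem_filter.1 hx).1, not_and_not_right.1 (Finset.mem_filter.1 hx).2⟩
  · rw [← hD, Finset.coe_inj]
    convert Finset.filter_union_filter_not_eq _ D

theorem Edited.sum_rightDeg_nadd_le (h : Edited T T' i (κ.off i) j) (hT' : EndsWithMarker d T')
    {D : Finset (List α)} (hD : ∀ x ∈ D, x ∈ Nadd κ i T T') :
    ∑ x ∈ D, rightDeg T' x ≤ D.card * 2 :=
  Finset.sum_le_card_nsmul _ _ _ fun x hx => (mem_nadd_iff.1 (hD x hx)).rightDeg_le_two h hT'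

theorem disjoint_nadd : Disjoint (N₁ T T' ∪ Nbase κ i T T') (Nadd κ i T T') :=
  Set.disjoint_left.2 fun _ hB hD =>
    hB.elim (fun hx => hD.1.2 (Or.inl hx)) fun hx => hx.2 hD

theorem Edited.size_add_le (h : Edited T T' i (κ.off i) j) (hT' : EndsWithMarker d T') :
    size T' + (Nmid κ i T T').ncard + 2 * (Nless κ i T T').ncard ≤
      2 * size T + 5 * (MR T).ncard + (N₂ T T').ncard + 3 := by
  classical
  obtain ⟨S, hS⟩ := (finite_maxSub T).exists_finset_coe
  obtain ⟨A, hA⟩ := exists_finset_of_subset_n (C := N₂ T T') fun _ hx => hx.1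
  obtain ⟨B, hB⟩ := exists_finset_of_subset_n (C := N₁ T T' ∪ Nbase κ i T T')
    fun _ hx => hx.elim (·.1) (·.1.1)
  obtain ⟨Q, K, hQ, hK, hD⟩ := exists_coe_union_eq_nadd κ i T T'
  have mem_B {x} (hx : x ∈ B) : x ∈ N₁ T T' ∪ Nbase κ i T T' := hB ▸ hx
  have disjoint_B : Disjoint B (Q ∪ K) := Finset.disjoint_coe.1 (hB ▸ hD ▸ disjoint_nadd)
  have split := size_le_sum_classes hS hA hB hD
  have sum_SA := h.sum_rightDeg_le hT' (fun x hx => hS ▸ hx) (fun x hx => hA ▸ hx) hQ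
  have sum_B := (sum_weight hB).symm.trans_le (h.sum_weight_le hT' fun _ => mem_B)
  have sum_D := h.sum_rightDeg_nadd_le hT' (D := Q ∪ K) fun x hx => hD ▸ hx
  have card_BQ := h.card_add_card_le hT' (fun x hx => h.isBase_of_mem (mem_B hx))
    (disjoint_B.mono_right Finset.subset_union_left) hQ
  have card_K := h.card_rest_le hT' hK
  have card_D := Finset.card_union_le Q K
  have card_A : A.card = (N₂ T T').ncard := hA ▸ (Set.ncard_coe_finset A).symm
  have card_S := ncard_maxSub T
  omega

end Size

end CDAWG

theorem mainTheorem2_general {α : Type*} (d : α) (κ : CDAWG.EditKind) (i : ℕ) (T T' : List α)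
    (hT' : CDAWG.EndsWithMarker d T') (hedit : CDAWG.IsEdit κ i T T') :
    (CDAWG.size T' : ℤ) ≤ 2 * (CDAWG.size T : ℤ) + 5 * ((CDAWG.MR T).ncard : ℤ)
      - ((CDAWG.Nmid κ i T T').ncard : ℤ) - 2 * ((CDAWG.Nless κ i T T').ncard : ℤ)
      + ((CDAWG.N₂ T T').ncard : ℤ) + 3 := by
  have := hedit.edited.size_add_le hT'
  omega

theorem mainTheorem2 {α : Type*} (d : α) (κ : CDAWG.EditKind) (i : ℕ) (T T' : List α)
    (hT : CDAWG.EndsWithMarker d T) (hT' : CDAWG.EndsWithMarker d T')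
    (hedit : CDAWG.IsEdit κ i T T') :
    (CDAWG.size T' : ℤ) ≤ 2 * (CDAWG.size T : ℤ) + 5 * ((CDAWG.MR T).ncard : ℤ)
      - ((CDAWG.Nmid κ i T T').ncard : ℤ) - 2 * ((CDAWG.Nless κ i T T').ncard : ℤ)
      + ((CDAWG.N₂ T T').ncard : ℤ) + 3 := by
  exact mainTheorem2_general d κ i T T' hT' hedit
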